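/- Let $n\ge 1$, $L\ge 1$, $r_1>0$, $0<\epsilon<\min\{1,r_1/n^2\}$, $x\in\mathbb R^n$. Let $f:\mathbb R^n\to\mathbb R$ be convex and $L$-Lipschitz in the sense that $\|g\|_\infty\le L$ for every subgradient $g$ of $f$ at any point, and let $f$ be given by an evaluation oracle with error $\epsilon$, i.e. by $\alpha:\mathbb R^n\to\mathbb R$ with $|\alpha-f|\le\epsilon$. Put $$\beta=\frac{2n^{1/3}L}{r_1^{2/3}\epsilon^{1/3}},\qquad l=2\sqrt{\frac{\epsilon}{n\beta}},\qquad s=\sqrt{n\epsilon\beta},\qquad \Lambda=2L.$$ The algorithm QuantumSubgradient is the following. 1. Choose $T\in\mathbb N$ with $2e^{-T/24}\le 750\,s/\Lambda$ and, if $T\ge 1$, $b,b_0\in\mathbb N$ such that $N=2^b$, $N_0=2^{b_0}$ satisfy $\frac{24\pi s}{\Lambda}\le\frac1N\le\frac{48\pi s}{\Lambda}$ and $\frac{N\epsilon}{2\Lambda l}\le\frac1{N_0}\le\frac{N\epsilon}{\Lambda l}$. 2. Sample $y$ uniformly from the points of a grid $a+l\,\mathbb Z^n$ (with any fixed $a\in\mathbb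 R^n$) in the cube $B_\infty(x,r_1)$. 3. Repeat $T$ times independently: apply Hadamard transforms to $n$ registers of $b$ bits in the state $|0\rangle$; make one query, $|u\rangle\mapsto e^{2\pi i\tilde F(u)}|u\rangle$ for $u\in G^n$, $G=\{-N/2,\dots,N/2-1\}$; apply the inverse quantum Fourier transform over $G$ to each register; measure $k\in G^n$, and record $e=\frac{2\Lambda}{N}k$. Here the query is an implementation of the phase oracle through $\alpha$: up to an additive constant (a global phase), $\tilde F(u)$ differs from $\frac{N}{2\Lambda l}\,\alpha\!\left(y+\frac lN u\right)$ by at most $\frac1{N_0}-\frac{N\epsilon}{2\Lambda l}$, so that its total error with respect to $F(u)=\frac{N}{2\Lambda l}\left[f\!\left(y+\frac lN u\right)-f(y)\right]$ is, up to an additive constant, at most $1/N_0$. 4. For each $i$: if more than $T/2$ of the $T$ values $e_i$ lie in some interval of length $3000\,s$, let $\tilde g_i$ be a median of the values in such an interval; otherwise let $\tilde g_i=0$. Output $\tilde g$. Then, for all admissible choices of $T,b,b_0$, of the grid, of the phases $\tilde F$ and of the intervals and medians, there is a real random variable $\zeta$, a function of the run of the algorithm, such that in every run $$f(q)\ \ge\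 f(x)+\langle\tilde g,q-x\rangle-\zeta\,\|q-x\|_\infty-4nr_1L\qquad\text{for all }q\in\mathbb R^n,$$ and $$\mathbb E\,\zeta\ \le\ \frac{5000\,L\,n^{5/3}\,\epsilon^{1/3}}{r_1^{1/3}} .$$ Moreover, the algorithm uses $\tilde O(1)$ queries: there is a universal constant $C$ such that for all such $n,L,r_1,\epsilon$ there are admissible $T,b,b_0$ for which the total number of queries is at most $C\log\left(2+Lr_1/\epsilon\right)$. -/

import Mathlib

namespace QSubgrad

/-! ### Convex functions, subgradients, evaluation oracles -/

/-- `g` is a subgradient of `f` at `x`. -/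
def IsSubgradient {n : ℕ} (f : (Fin n → ℝ) → ℝ) (x g : Fin n → ℝ) : Prop :=
  ∀ y, f x + ∑ i, g i * (y i - x i) ≤ f y

/-- `f` is `L`-Lipschitz: every subgradient `g` of `f`, at every point, has `‖g‖_∞ ≤ L`. -/
def IsSubgradLipschitz {n : ℕ} (f : (Fin n → ℝ) → ℝ) (L : ℝ) : Prop :=
  ∀ x g, IsSubgradient f x g → ∀ i, |g i| ≤ L

/-- `α z` is the answer, with error at most `ε`, of an evaluation oracle for `f` queried at `z`. -/
def IsEvalOracle {n : ℕ} (f : (Fin n → ℝ) → ℝ) (ε : ℝ) (α : (Fin n → ℝ) → ℝ) : Prop :=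
  ∀ z, |α z - f z| ≤ ε

/-! ### Quantum circuits with queries to a phase oracle -/

section Circuits

variable {ι : Type} [Fintype ι] [DecidableEq ι]

/-- A gate on the Hilbert space with orthonormal basis `ι`: a fixed unitary that does not depend
on the oracle, or one call to the oracle. -/
inductive Gate (ι : Type) [Fintype ι] [DecidableEq ι] : Type
  | unitary (U : Matrix.unitaryGroup ι ℂ) : Gate ι
  | query : Gate ι

/-- Apply a gate; the oracle acts by `|x⟩ ↦ e^{2πi φ(x)} |x⟩`. -/
noncomputable def applyGate (φ : ι → ℝ) (ψ : ι → ℂ) : Gate ι → ι → ℂ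
  | Gate.unitary U => (U : Matrix ι ι ℂ).mulVec ψ
  | Gate.query => fun x => Complex.exp (2 * Real.pi * Complex.I * (φ x : ℂ)) * ψ x

/-- The final state of a circuit (a list of gates, the first one acting first). -/
noncomputable def runCircuit (φ : ι → ℝ) (c : List (Gate ι)) (ψ : ι → ℂ) : ι → ℂ :=
  c.foldl (applyGate φ) ψ

/-- The number of oracle calls of a circuit. -/
def queryCount : List (Gate ι) → ℕ
  | [] => 0
  | Gate.unitary _ :: c => queryCount c
  | Gate.query :: c => queryCount c + 1

/-- The probability of the outcome `k` when `ψ` is measured in the standard basis. -/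
noncomputable def bornProb (ψ : ι → ℂ) (k : ι) : ℝ := ‖ψ k‖ ^ 2

/-- The operator `M ⊗ ⋯ ⊗ M` on `m` copies of a register. -/
def tensorPow (m : ℕ) (M : Matrix ι ι ℂ) : Matrix (Fin m → ι) (Fin m → ι) ℂ :=
  fun x y => ∏ i, M (x i) (y i)

theorem tensorPow_mem (m : ℕ) {M : Matrix ι ι ℂ} (hM : M ∈ Matrix.unitaryGroup ι ℂ) :
    tensorPow m M ∈ Matrix.unitaryGroup (Fin m → ι) ℂ := by
  rw [Matrix.mem_unitaryGroup_iff] at hM ⊢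
  ext x y
  have h : ∀ a b, ∑ j, M a j * star (M b j) = (1 : Matrix ι ι ℂ) a b := by
    intro a b
    rw [← hM]
    simp [Matrix.mul_apply, Matrix.star_apply]
  have h2 : (tensorPow m M * star (tensorPow m M)) x y
      = ∏ i, ∑ j, M (x i) j * star (M (y i) j) := by
    rw [Finset.prod_univ_sum, Fintype.piFinset_univ, Matrix.mul_apply]
    refine Finset.sum_congr rfl fun z _ => ?_
    simp [tensorPow, Matrix.star_apply, Finset.prod_mul_distrib]
  rw [h2]
  simp only [h, Matrix.one_apply]
  by_cases hxy : x = y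
  · simp [hxy]
  · rw [if_neg hxy]
    obtain ⟨i, hi⟩ := Function.ne_iff.mp hxy
    exact Finset.prod_eq_zero (Finset.mem_univ i) (if_neg hi)

end Circuits

/-- The `2 × 2` Hadamard matrix. -/
noncomputable def hadamard₂ : Matrix (Fin 2) (Fin 2) ℂ :=
  fun x y => (-1) ^ ((x : ℕ) * (y : ℕ)) / (Real.sqrt 2 : ℂ)

theorem hadamard₂_mem : hadamard₂ ∈ Matrix.unitaryGroup (Fin 2) ℂ := by
  rw [Matrix.mem_unitaryGroup_iff]
  have h : ((Real.sqrt 2 : ℝ) : ℂ) * ((Real.sqrt 2 : ℝ) : ℂ) = 2 := by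
    rw [← Complex.ofReal_mul, Real.mul_self_sqrt (by norm_num)]
    norm_num
  have h0 : ((Real.sqrt 2 : ℝ) : ℂ) ≠ 0 := by
    intro h1
    rw [h1] at h
    norm_num at h
  ext x y
  fin_cases x <;> fin_cases y <;>
    simp [hadamard₂, Matrix.mul_apply, Matrix.star_apply] <;> field_simp <;>
    simp [pow_two, h] <;> norm_num

/-- The Hadamard transform of one `b`-bit register: a Hadamard gate on each of its bits. -/
noncomputable def hadamardReg (b : ℕ) : Matrix (Fin (2 ^ b)) (Fin (2 ^ b)) ℂ :=
  Matrix.reindex finFunctionFinEquiv finFunctionFinEquiv (tensorPow b hadamard₂)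

theorem hadamardReg_mem (b : ℕ) : hadamardReg b ∈ Matrix.unitaryGroup (Fin (2 ^ b)) ℂ := by
  have h := tensorPow_mem b hadamard₂_mem
  rw [Matrix.mem_unitaryGroup_iff] at h ⊢
  have hs : star (hadamardReg b)
      = Matrix.reindex finFunctionFinEquiv finFunctionFinEquiv
          (star (tensorPow b hadamard₂)) := rfl
  rw [hs, hadamardReg, Matrix.reindex_apply, Matrix.reindex_apply,
    Matrix.submatrix_mul_equiv, h, Matrix.submatrix_one_equiv]

/-- The bijection `γ(x) = x - N/2` from `{0, …, N-1}` to `G = {-N/2, …, N/2 - 1}`, `N = 2 ^ b`. -/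
noncomputable def gam (b : ℕ) (x : Fin (2 ^ b)) : ℝ := (x : ℝ) - (2 : ℝ) ^ b / 2

/-- The inverse quantum Fourier transform over `G` on one register,
`|γ(x)⟩ ↦ N^{-1/2} ∑_y e^{-2πi γ(x) γ(y) / N} |γ(y)⟩`; the basis vector `|γ(x)⟩` has index `x`. -/
noncomputable def invQFT (b : ℕ) : Matrix (Fin (2 ^ b)) (Fin (2 ^ b)) ℂ :=
  fun y x => Complex.exp (-(2 * Real.pi * Complex.I) * ((gam b x * gam b y / 2 ^ b : ℝ) : ℂ)) /
    (Real.sqrt (2 ^ b) : ℂ)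

theorem invQFT_mem (b : ℕ) : invQFT b ∈ Matrix.unitaryGroup (Fin (2 ^ b)) ℂ := by
  rw [Matrix.mem_unitaryGroup_iff]
  have hN : (0 : ℝ) < 2 ^ b := by positivity
  have hNC : ((2 : ℂ) ^ b) ≠ 0 := pow_ne_zero _ two_ne_zero
  have hs : ((Real.sqrt (2 ^ b) : ℝ) : ℂ) * ((Real.sqrt (2 ^ b) : ℝ) : ℂ) = 2 ^ b := by
    rw [← Complex.ofReal_mul, Real.mul_self_sqrt hN.le]
    push_cast
    rfl
  have hprim : IsPrimitiveRoot (Complex.exp (2 * Real.pi * Complex.I / ((2 ^ b : ℕ) : ℂ))) (2 ^ b) :=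
    Complex.isPrimitiveRoot_exp (2 ^ b) (by positivity)
  set ω := Complex.exp (2 * Real.pi * Complex.I / ((2 ^ b : ℕ) : ℂ)) with hω
  ext y y'
  have hterm : ∀ z : Fin (2 ^ b), invQFT b y z * star (invQFT b y' z)
      = Complex.exp (-(Real.pi * Complex.I) * (((y' : ℕ) : ℤ) - ((y : ℕ) : ℤ) : ℤ)) / 2 ^ b
        * (ω ^ (((y' : ℕ) : ℤ) - ((y : ℕ) : ℤ))) ^ (z : ℕ) := by
    intro z
    rw [hω, ← Complex.exp_int_mul, ← Complex.exp_nat_mul]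
    simp only [invQFT, gam, Complex.star_def, map_div₀, ← Complex.exp_conj, Complex.conj_ofReal,
      map_mul, map_neg, Complex.conj_I, map_ofNat]
    rw [div_mul_div_comm, hs, ← Complex.exp_add, div_mul_eq_mul_div, ← Complex.exp_add]
    congr 2
    push_cast
    field_simp
    ring
  simp only [Matrix.mul_apply, Matrix.star_apply, hterm, ← Finset.mul_sum]
  rw [Fin.sum_univ_eq_sum_range
    (fun z => (ω ^ (((y' : ℕ) : ℤ) - ((y : ℕ) : ℤ))) ^ z) (2 ^ b)]
  by_cases hyy : y = y'
  · subst hyy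
    simp [hNC]
  · rw [Matrix.one_apply_ne hyy]
    have hne : ω ^ (((y' : ℕ) : ℤ) - ((y : ℕ) : ℤ)) ≠ 1 := by
      intro h1
      rw [hprim.zpow_eq_one_iff_dvd] at h1
      have h2 := Int.eq_zero_of_abs_lt_dvd h1 (by
        have := y.isLt
        have := y'.isLt
        rw [abs_lt]
        constructor <;> omega)
      exact hyy (Fin.ext (by omega))
    have hpow : (ω ^ (((y' : ℕ) : ℤ) - ((y : ℕ) : ℤ))) ^ (2 ^ b) = 1 := by
      rw [← zpow_natCast, zpow_comm, zpow_natCast, hprim.pow_eq_one, one_zpow]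
    rw [geom_sum_eq hne, hpow]
    simp

/-! ### Gradient estimation -/

/-- The basis labels of `n` registers of `b` bits each. -/
abbrev Reg (n b : ℕ) : Type := Fin n → Fin (2 ^ b)

/-- The state `|0, …, 0⟩`. -/
noncomputable def zeroKet (n b : ℕ) : Reg n b → ℂ :=
  Pi.single (fun _ => ⟨0, by positivity⟩) 1

/-- The circuit of `GradientEstimate`: Hadamard transforms, one oracle call, inverse Fourier
transforms over `G`. -/
noncomputable def gradientCircuit (n b : ℕ) : List (Gate (Reg n b)) :=
  [Gate.unitary ⟨tensorPow n (hadamardReg b), tensorPow_mem n (hadamardReg_mem b)⟩,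
   Gate.query,
   Gate.unitary ⟨tensorPow n (invQFT b), tensorPow_mem n (invQFT_mem b)⟩]

/-- The probability that one run of `GradientEstimate`, with the phase oracle `|x⟩ ↦ e^{2πi φ(x)}|x⟩`,
measures `k`. -/
noncomputable def measureProb {n b : ℕ} (φ : Reg n b → ℝ) (k : Reg n b) : ℝ :=
  bornProb (runCircuit φ (gradientCircuit n b) (zeroKet n b)) k

/-- The grid size `l = 2 √(ε / (n β))`. -/
noncomputable def gridSize (n : ℕ) (ε β : ℝ) : ℝ := 2 * Real.sqrt (ε / (n * β))

/-- The scale `√(n ε β)` of the estimation error. -/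
noncomputable def errScale (n : ℕ) (ε β : ℝ) : ℝ := Real.sqrt (n * ε * β)

/-- The estimate `(2 L / N) (k₁, …, kₙ)` reported for the measured `k ∈ Gⁿ`. -/
noncomputable def estimate {n b : ℕ} (L : ℝ) (k : Reg n b) : Fin n → ℝ :=
  fun i => 2 * L / 2 ^ b * gam b (k i)

/-- `Ft` is the phase function of an implementation of `O_F` by means of the evaluation oracle `α`,
which has error `ε`. Here `F(x) = N/(2Ll) [f(x₀ + (l/N)(x - N/2)) - f(x₀)]`, and the total error,
made of the oracle error `N ε / (2Ll)` and of the error of representing the phase, is at most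
`1/N₀ = 2 ^ (-b₀)`. The constant `c` in place of `f(x₀)` only contributes a global phase. -/
def IsPhaseOracle {n b : ℕ} (α : (Fin n → ℝ) → ℝ) (ε L β : ℝ) (x₀ : Fin n → ℝ) (b₀ : ℕ)
    (Ft : Reg n b → ℝ) : Prop :=
  ∃ c : ℝ, ∀ x : Reg n b,
    |Ft x - 2 ^ b / (2 * L * gridSize n ε β) *
        (α (fun i => x₀ i + gridSize n ε β / 2 ^ b * gam b (x i)) - c)|
      + 2 ^ b * ε / (2 * L * gridSize n ε β) ≤ 1 / 2 ^ b₀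

/-- The parameters of `SmoothQuantumGradient` and of the calls of `GradientEstimate` in it: the
number `T` of repetitions, and, if there is any repetition, the numbers `b` and `b₀` of bits
(`N = 2 ^ b`, `N₀ = 2 ^ b₀`). -/
structure ValidParams (n : ℕ) (ε L β : ℝ) (b b₀ T : ℕ) : Prop where
  rounds : 2 * Real.exp (-(T : ℝ) / 24) ≤ 750 * errScale n ε β / L
  bits : 0 < T → 24 * Real.pi * errScale n ε β / L ≤ 1 / 2 ^ b ∧
    (1 : ℝ) / 2 ^ b ≤ 48 * Real.pi * errScale n ε β / L
  precision : 0 < T → 2 ^ b * ε / (2 * L * gridSize n ε β) ≤ 1 / 2 ^ b₀ ∧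
    (1 : ℝ) / 2 ^ b₀ ≤ 2 ^ b * ε / (L * gridSize n ε β)

/-- `m` is a median of the numbers `e t`, `t ∈ S`. -/
def IsMedian {T : ℕ} (S : Finset (Fin T)) (e : Fin T → ℝ) (m : ℝ) : Prop :=
  S.card ≤ 2 * (S.filter fun t => e t ≤ m).card ∧ S.card ≤ 2 * (S.filter fun t => m ≤ e t).card

/-- The rounds whose value lies in the interval `[a, a + w]`. -/
noncomputable def inInterval {T : ℕ} (e : Fin T → ℝ) (a w : ℝ) : Finset (Fin T) :=
  Finset.univ.filter fun t => a ≤ e t ∧ e t ≤ a + w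

/-- The rule that combines the values `e t` of one coordinate in the `T` rounds: if more than `T/2`
of them lie in an interval of size `w`, then `m` is the median of the values in such an interval,
otherwise `m = 0`. -/
def IsMajorityMedian {T : ℕ} (w : ℝ) (e : Fin T → ℝ) (m : ℝ) : Prop :=
  (∃ a, T < 2 * (inInterval e a w).card ∧ IsMedian (inInterval e a w) e m) ∨
    ((¬ ∃ a, T < 2 * (inInterval e a w).card) ∧ m = 0)

/-- `out` computes the output of `SmoothQuantumGradient` from the outcomes of the `T`
measurements. -/
def IsSmoothOutput {n b T : ℕ} (ε L β : ℝ) (out : (Fin T → Reg n b) → Fin n → ℝ) : Prop :=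
  ∀ k i, IsMajorityMedian (3000 * errScale n ε β) (fun t => estimate L (k t) i) (out k i)

/-! ### The subgradient algorithm -/

/-- The smoothness parameter `2 n^{1/3} L / (r₁^{2/3} ε^{1/3})` of `QuantumSubgradient`. -/
noncomputable def smoothParam (n : ℕ) (ε L r₁ : ℝ) : ℝ :=
  2 * (n : ℝ) ^ (1 / 3 : ℝ) * L / (r₁ ^ (2 / 3 : ℝ) * ε ^ (1 / 3 : ℝ))

/-- The grid point `a + l m` with index `m ∈ ℤⁿ`. -/
def gridPoint {n : ℕ} (a : Fin n → ℝ) (l : ℝ) (m : Fin n → ℤ) : Fin n → ℝ :=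
  fun i => a i + l * m i

/-- The indices of the points of the grid `a + l ℤⁿ` in the cube `B_∞(x, r₁)`. -/
noncomputable def gridIn {n : ℕ} (x : Fin n → ℝ) (r₁ : ℝ) (a : Fin n → ℝ) (l : ℝ) :
    Finset (Fin n → ℤ) :=
  Fintype.piFinset fun i => Finset.Icc ⌈(x i - r₁ - a i) / l⌉ ⌊(x i + r₁ - a i) / l⌋

theorem mem_gridIn {n : ℕ} (x : Fin n → ℝ) {r₁ : ℝ} (hr : 0 ≤ r₁) (a : Fin n → ℝ) {l : ℝ}
    (hl : 0 < l) (m : Fin n → ℤ) : m ∈ gridIn x r₁ a l ↔ ‖gridPoint a l m - x‖ ≤ r₁ := by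
  simp only [gridIn, Fintype.mem_piFinset, Finset.mem_Icc, Int.ceil_le, Int.le_floor,
    pi_norm_le_iff_of_nonneg hr, gridPoint, Pi.sub_apply, Real.norm_eq_abs, abs_le,
    div_le_iff₀ hl, le_div_iff₀ hl]
  refine forall_congr' fun i => ?_
  constructor <;> rintro ⟨h1, h2⟩ <;> constructor <;> linarith

/-- The expectation of a function of a run of `QuantumSubgradient`: the sample `y = a + l m` is
uniform in the grid, and, given `y`, the `T` runs of `GradientEstimate` at `y` are independent, with
phase oracle `Ft m`. -/
noncomputable def runExpectation {n b T : ℕ} (grid : Finset (Fin n → ℤ))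
    (Ft : (Fin n → ℤ) → Reg n b → ℝ) (ζ : (Fin n → ℤ) → (Fin T → Reg n b) → ℝ) : ℝ :=
  (∑ m ∈ grid, ∑ k : Fin T → Reg n b, (∏ t, measureProb (Ft m) (k t)) * ζ m k) / (grid.card : ℝ)

/-- The number of oracle calls in a run of `QuantumSubgradient`. -/
noncomputable def totalQueries (n b T : ℕ) : ℕ :=
  ∑ _t : Fin T, queryCount (gradientCircuit n b)

end QSubgrad

namespace QSubgrad

/-! ### Convex functions and their subgradients -/

/-! Take for ζ the ℓ₁-distance between the output and a fixed subgradient `g m` at the sampled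
point. The lower bound on `f` then holds in every run: it is the subgradient inequality at the
sampled point, moved to `x` at a cost of order `n r₁ L` (`subgradient_inequality`). What remains is
the expectation of ζ.

On the cell of a grid point, convexity bounds the deviation of `f` from its linearization by the
second differences with step `n l` (`linearization_error_le`). Summed over the grid these telescope
to boundary terms, which the Lipschitz bound controls (`sum_grid_secondDiff_le`). So `f` is linear
up to `ε/10` around most grid points, and no smoothing is needed.

At such a good point the queried phase is nearly linear. Fourier sampling of an exactly linear phase
gives a product distribution with explicit sine-kernel tails; unitarity controls the perturbation.
One round is thus farther than `1500 s` from `g m` in a given coordinate with probability at most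
`0.14` (`sum_measureProb_estimate_far_le`), and the majority median makes this exponentially small
in `T` (`sum_prod_quarter_le`). At a bad point the error is at most `3L` per coordinate, which is
charged to the second difference as in Markov's inequality. In terms of `τ = (n²ε/r₁)^{1/3}`, both
contributions are of order `L τ` per coordinate (`runExpectation_le`).

Each round makes one query, and `T` is logarithmic in `L / s`, where `s` is at least `ε / r₁`. -/

theorem exists_isSubgradient {n : ℕ} {f : (Fin n → ℝ) → ℝ} (hf : ConvexOn ℝ Set.univ f)
    (x : Fin n → ℝ) : ∃ g, IsSubgradient f x g := by
  have hc : Continuous f := continuousOn_univ.1 (hf.continuousOn isOpen_univ)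
  have hopen : IsOpen {p : (Fin n → ℝ) × ℝ | p.1 ∈ Set.univ ∧ f p.1 < p.2} := by
    simpa using isOpen_lt (hc.comp continuous_fst) continuous_snd
  obtain ⟨φ, hφ⟩ := geometric_hahn_banach_open_point hf.convex_strict_epigraph hopen
    (x := (x, f x)) (by simp)
  have hsplit : ∀ z t, φ (z, t) = φ (z, 0) + t * φ (0, 1) := by
    intro z t
    have h : ((z, t) : (Fin n → ℝ) × ℝ) = (z, 0) + t • (0, 1) := by simp
    rw [h, map_add, map_smul, smul_eq_mul]
  -- The strict epigraph contains points directly above `(x, f x)`, so the separating hyperplane is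
  -- not vertical and its functional can be normalized.
  have hneg : φ (0, 1) < 0 := by
    have h := hφ (x, f x + 1) (by simp)
    rw [hsplit, hsplit x (f x)] at h
    linarith
  have hlin : ∀ z, φ (z, 0) = ∑ i, z i * φ (Pi.single i 1, 0) := by
    intro z
    have h := LinearMap.pi_apply_eq_sum_univ
      (φ.toLinearMap.comp (LinearMap.inl ℝ (Fin n → ℝ) ℝ)) z
    simp only [LinearMap.comp_apply, LinearMap.inl_apply, ContinuousLinearMap.coe_coe,
      smul_eq_mul] at h
    rw [h]
    refine Finset.sum_congr rfl fun i _ => ?_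
    congr 3
    ext j
    simp [Pi.single_apply, eq_comm]
  refine ⟨fun i => φ (Pi.single i 1, 0) / -φ (0, 1), fun y => ?_⟩
  have hle : φ (y, 0) - φ (x, 0) ≤ (f y - f x) * -φ (0, 1) := by
    refine le_of_forall_pos_lt_add fun δ hδ => ?_
    have h := hφ (y, f y + δ / -φ (0, 1)) (by
      have : 0 < δ / -φ (0, 1) := div_pos hδ (by linarith)
      simpa using this)
    rw [hsplit, hsplit x (f x)] at h
    have h2 : δ / -φ (0, 1) * φ (0, 1) = -δ := by
      rw [div_neg, neg_mul, div_mul_cancel₀ _ hneg.ne]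
    rw [add_mul, h2] at h
    linarith
  have hs : ∑ i, φ (Pi.single i 1, 0) / -φ (0, 1) * (y i - x i)
      = (φ (y, 0) - φ (x, 0)) / -φ (0, 1) := by
    rw [hlin y, hlin x, ← Finset.sum_sub_distrib, Finset.sum_div]
    exact Finset.sum_congr rfl fun i _ => by ring
  rw [hs]
  have := (div_le_iff₀ (neg_pos.2 hneg)).2 hle
  linarith

theorem sub_le_of_isSubgradLipschitz {n : ℕ} {f : (Fin n → ℝ) → ℝ} {L : ℝ}
    (hf : ConvexOn ℝ Set.univ f) (hL : IsSubgradLipschitz f L) (y z : Fin n → ℝ) :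
    f y - f z ≤ L * ∑ i, |y i - z i| := by
  obtain ⟨g, hg⟩ := exists_isSubgradient hf y
  have h := hg z
  have h2 : -∑ i, g i * (z i - y i) ≤ L * ∑ i, |y i - z i| := by
    rw [← Finset.sum_neg_distrib, Finset.mul_sum]
    refine Finset.sum_le_sum fun i _ => ?_
    calc -(g i * (z i - y i)) = g i * (y i - z i) := by ring
      _ ≤ |g i * (y i - z i)| := le_abs_self _
      _ = |g i| * |y i - z i| := abs_mul _ _
      _ ≤ L * |y i - z i| := mul_le_mul_of_nonneg_right (hL y g hg i) (abs_nonneg _)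
  linarith

theorem abs_sub_le_of_isSubgradLipschitz {n : ℕ} {f : (Fin n → ℝ) → ℝ} {L : ℝ}
    (hf : ConvexOn ℝ Set.univ f) (hL : IsSubgradLipschitz f L) (y z : Fin n → ℝ) :
    |f y - f z| ≤ L * ∑ i, |y i - z i| := by
  refine abs_le.2 ⟨?_, sub_le_of_isSubgradLipschitz hf hL y z⟩
  have h := sub_le_of_isSubgradLipschitz hf hL z y
  simp only [abs_sub_comm (z _)] at h
  linarith

/-- The sum of the second differences of `f` at `y` in the coordinate directions. -/
noncomputable def secondDiff {n : ℕ} (f : (Fin n → ℝ) → ℝ) (h : ℝ) (y : Fin n → ℝ) : ℝ :=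
  ∑ i, (f (y + Pi.single i h) + f (y - Pi.single i h) - 2 * f y)

/-- On a cube about `y`, the deviation of a convex function from its linearization at `y` is
controlled by the average of the second differences with an `n` times larger step. -/
theorem linearization_error_le {n : ℕ} (hn : 0 < n) {f : (Fin n → ℝ) → ℝ}
    (hf : ConvexOn ℝ Set.univ f) {y g w : Fin n → ℝ} (hg : IsSubgradient f y g) {h : ℝ}
    (hh : 0 < h) (hw : ∀ i, n * |w i - y i| ≤ h) :
    f w - f y - ∑ i, g i * (w i - y i) ≤ secondDiff f h y / n := by
  have hn' : (0 : ℝ) < n := by exact_mod_cast hn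
  -- Along an axis, the deviation from the linearization is convex and nonnegative, so on `[-h, h]`
  -- it is at most the sum of its two end values. In that sum the linear terms cancel and leave the
  -- second difference.
  have hdir : ∀ i, f (y + Pi.single i (n * (w i - y i))) - n * (g i * (w i - y i)) - f y
      ≤ f (y + Pi.single i h) + f (y - Pi.single i h) - 2 * f y := by
    intro i
    set t := n * (w i - y i) with ht
    have hth : |t| ≤ h := by rw [ht, abs_mul, abs_of_pos hn']; exact hw i
    rw [abs_le] at hth
    have hp := hg (y + Pi.single i h)
    have hm := hg (y - Pi.single i h)
    have e1 : ∑ j, g j * ((y + Pi.single i h : Fin n → ℝ) j - y j) = g i * h := by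
      simp [Pi.single_apply]
    have e2 : ∑ j, g j * ((y - Pi.single i h : Fin n → ℝ) j - y j) = -(g i * h) := by
      simp [Pi.single_apply]
    rw [e1] at hp
    rw [e2] at hm
    have hcomb : y + Pi.single i t = ((h + t) / (2 * h)) • (y + Pi.single i h)
        + ((h - t) / (2 * h)) • (y - Pi.single i h) := by
      ext j
      by_cases hj : j = i
      · subst hj
        simp only [Pi.add_apply, Pi.sub_apply, Pi.smul_apply, Pi.single_eq_same, smul_eq_mul]
        field_simp
        ring
      · simp only [Pi.add_apply, Pi.sub_apply, Pi.smul_apply, Pi.single_eq_of_ne hj, smul_eq_mul]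
        field_simp
        ring
    have ha : 0 ≤ (h + t) / (2 * h) := div_nonneg (by linarith) (by linarith)
    have hb : 0 ≤ (h - t) / (2 * h) := div_nonneg (by linarith) (by linarith)
    have hab : (h + t) / (2 * h) + (h - t) / (2 * h) = 1 := by field_simp; ring
    have hc := hf.2 (Set.mem_univ (y + Pi.single i h)) (Set.mem_univ (y - Pi.single i h)) ha hb hab
    rw [← hcomb, smul_eq_mul, smul_eq_mul] at hc
    have hgt : n * (g i * (w i - y i)) = g i * t := by rw [ht]; ring
    have hgt' : g i * t = (h + t) / (2 * h) * (g i * h) - (h - t) / (2 * h) * (g i * h) := by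
      field_simp; ring
    rw [hgt]
    have h1 := mul_nonneg hb (sub_nonneg.2 hp)
    have h2 := mul_nonneg ha (sub_nonneg.2 hm)
    have eb : (h - t) / (2 * h) = 1 - (h + t) / (2 * h) := by linarith
    rw [eb] at hc hgt' h1
    nlinarith
  -- `w` is the mean of `n` points, each displaced from `y` along one axis by `n` times the
  -- coordinate of `w - y`. This is where the factor `n` in the step comes from.
  have hsum : w = ∑ i : Fin n, (1 / n : ℝ) • (y + Pi.single i (n * (w i - y i)) : Fin n → ℝ) := by
    ext j
    simp only [Finset.sum_apply, Pi.smul_apply, Pi.add_apply, smul_eq_mul, mul_add,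
      Finset.sum_add_distrib, Finset.sum_const, Finset.card_univ, Fintype.card_fin, nsmul_eq_mul,
      Pi.single_apply, mul_ite, mul_zero, Finset.sum_ite_eq, Finset.mem_univ, if_true]
    field_simp
    ring
  have hJ := hf.map_sum_le (t := Finset.univ) (w := fun _ : Fin n => (1 / n : ℝ))
    (p := fun i => (y + Pi.single i (n * (w i - y i)) : Fin n → ℝ)) (fun _ _ => by positivity)
    (by simp [hn'.ne']) (fun _ _ => Set.mem_univ _)
  rw [← hsum] at hJ
  have hS := Finset.sum_le_sum fun i (_ : i ∈ Finset.univ) => hdir i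
  rw [Finset.sum_sub_distrib, Finset.sum_sub_distrib, ← Finset.mul_sum] at hS
  simp only [smul_eq_mul, ← Finset.mul_sum] at hJ
  simp only [Finset.sum_const, Finset.card_univ, Fintype.card_fin, nsmul_eq_mul] at hS
  rw [le_div_iff₀ hn', secondDiff]
  have hJ' := mul_le_mul_of_nonneg_left hJ hn'.le
  rw [← mul_assoc, mul_one_div_cancel hn'.ne', one_mul] at hJ'
  nlinarith

theorem secondDiff_nonneg {n : ℕ} {f : (Fin n → ℝ) → ℝ} (hf : ConvexOn ℝ Set.univ f) (h : ℝ)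
    (y : Fin n → ℝ) : 0 ≤ secondDiff f h y := by
  obtain ⟨g, hg⟩ := exists_isSubgradient hf y
  refine Finset.sum_nonneg fun i _ => ?_
  have hp := hg (y + Pi.single i h)
  have hm := hg (y - Pi.single i h)
  simp [Pi.single_apply] at hp hm
  linarith

/-! ### Second differences on a grid -/

theorem card_mul_card_piFinset_update {n : ℕ} (S : Fin n → Finset ℤ) (i : Fin n) (A : Finset ℤ) :
    (S i).card * (Fintype.piFinset (Function.update S i A)).card
      = A.card * (Fintype.piFinset S).card := by
  rw [Fintype.card_piFinset, Fintype.card_piFinset, ← Finset.mul_prod_erase _ _ (Finset.mem_univ i),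
    ← Finset.mul_prod_erase _ (fun j => (S j).card) (Finset.mem_univ i), Function.update_self]
  have : ∏ j ∈ Finset.univ.erase i, (Function.update S i A j).card
      = ∏ j ∈ Finset.univ.erase i, (S j).card :=
    Finset.prod_congr rfl fun j hj => by rw [Function.update_of_ne (Finset.ne_of_mem_erase hj)]
  rw [this]
  ring

/-- Along each line of a box the second differences of a Lipschitz function telescope. -/
theorem sum_box_second_difference_le {n : ℕ} (lo hi : Fin n → ℤ) (φ : (Fin n → ℤ) → ℝ) (i : Fin n)
    (d : ℕ) {B : ℝ} (hB : ∀ m, |φ m - φ (m - Pi.single i (d : ℤ))| ≤ B) :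
    ((Finset.Icc (lo i) (hi i)).card : ℝ) *
        ∑ m ∈ Fintype.piFinset fun j => Finset.Icc (lo j) (hi j),
          (φ (m + Pi.single i (d : ℤ)) + φ (m - Pi.single i (d : ℤ)) - 2 * φ m)
      ≤ 2 * d * B * (Fintype.piFinset fun j => Finset.Icc (lo j) (hi j)).card := by
  set S : Fin n → Finset ℤ := fun j => Finset.Icc (lo j) (hi j) with hS
  set G := Fintype.piFinset S with hG
  set e : Fin n → ℤ := Pi.single i (d : ℤ) with he
  set G' := G.map (addRightEmbedding e) with hG'
  have hB0 : 0 ≤ B := (abs_nonneg _).trans (hB 0)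
  have hmemG' : ∀ m, m ∈ G' ↔ m - e ∈ G := by
    intro m
    simp only [hG', Finset.mem_map, addRightEmbedding_apply]
    exact ⟨fun ⟨a, ha, h⟩ => by rw [← h, add_sub_cancel_right]; exact ha,
      fun h => ⟨m - e, h, sub_add_cancel _ _⟩⟩
  -- A second difference is a first difference at `m + e` minus the one at `m`. The sum over the
  -- shifted box minus the sum over the box cancels on their intersection.
  have hsum : ∑ m ∈ G, (φ (m + e) + φ (m - e) - 2 * φ m)
      = ∑ m ∈ G' \ G, (φ m - φ (m - e)) - ∑ m ∈ G \ G', (φ m - φ (m - e)) := by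
    rw [Finset.sum_sdiff_sub_sum_sdiff, hG', Finset.sum_map, ← Finset.sum_sub_distrib]
    refine Finset.sum_congr rfl fun m _ => ?_
    simp only [addRightEmbedding_apply, add_sub_cancel_right]
    ring
  have hbound : ∀ A : Finset (Fin n → ℤ), |∑ m ∈ A, (φ m - φ (m - e))| ≤ A.card * B := by
    intro A
    refine (Finset.abs_sum_le_sum_abs _ _).trans ?_
    rw [← nsmul_eq_mul]
    exact Finset.sum_le_card_nsmul _ _ _ fun m _ => hB m
  have hcoord : ∀ m : Fin n → ℤ, (∀ j, j ≠ i → (m - e) j = m j) ∧ (m - e) i = m i - d := by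
    intro m
    refine ⟨fun j hj => ?_, ?_⟩ <;> simp [*]
  have hcard : ∀ (A : Finset (Fin n → ℤ)) (I : Finset ℤ), I.card = d →
      A ⊆ Fintype.piFinset (Function.update S i I) → ((S i).card : ℝ) * A.card ≤ d * G.card := by
    intro A I hI hA
    have h := card_mul_card_piFinset_update S i I
    rw [hI] at h
    calc ((S i).card : ℝ) * A.card
        ≤ (S i).card * (Fintype.piFinset (Function.update S i I)).card := by
          gcongr
      _ = d * G.card := by exact_mod_cast h
  have hupd : ∀ (m : Fin n → ℤ) (I : Finset ℤ), m i ∈ I → (∀ j, j ≠ i → m j ∈ S j) →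
      m ∈ Fintype.piFinset (Function.update S i I) := by
    intro m I h1 h2
    rw [Fintype.mem_piFinset]
    intro j
    by_cases hj : j = i
    · subst hj; simpa using h1
    · rw [Function.update_of_ne hj]; exact h2 j hj
  have h1 := hcard (G' \ G) (Finset.Ioc (hi i) (hi i + d)) (by simp) (by
    intro m hm
    rw [Finset.mem_sdiff, hmemG', hG, Fintype.mem_piFinset, Fintype.mem_piFinset] at hm
    have hj : ∀ j, j ≠ i → m j ∈ S j := fun j hj => by
      have := hm.1 j; rwa [(hcoord m).1 j hj] at this
    refine hupd m _ ?_ hj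
    have hi1 := hm.1 i
    rw [(hcoord m).2] at hi1
    have hi2 : m i ∉ S i := fun hc => hm.2 fun j => by
      by_cases h : j = i
      · subst h; exact hc
      · exact hj j h
    simp only [hS, Finset.mem_Icc, Finset.mem_Ioc] at hi1 hi2 ⊢
    omega)
  have h2 := hcard (G \ G') (Finset.Ico (lo i) (lo i + d)) (by simp) (by
    intro m hm
    rw [Finset.mem_sdiff, hmemG', hG, Fintype.mem_piFinset, Fintype.mem_piFinset] at hm
    refine hupd m _ ?_ fun j _ => hm.1 j
    have hi1 := hm.1 i
    have hi2 : m i - d ∉ S i := fun hc => hm.2 fun j => by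
      by_cases h : j = i
      · subst h; rw [(hcoord m).2]; exact hc
      · rw [(hcoord m).1 j h]; exact hm.1 j
    simp only [hS, Finset.mem_Icc, Finset.mem_Ico] at hi1 hi2 ⊢
    omega)
  have hx : ∑ m ∈ G, (φ (m + e) + φ (m - e) - 2 * φ m)
      ≤ (G' \ G).card * B + (G \ G').card * B := by
    rw [hsum]
    have := (abs_le.1 (hbound (G' \ G))).2
    have := (abs_le.1 (hbound (G \ G'))).1
    linarith
  calc ((S i).card : ℝ) * ∑ m ∈ G, (φ (m + e) + φ (m - e) - 2 * φ m)
      ≤ (S i).card * ((G' \ G).card * B + (G \ G').card * B) := by gcongr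
    _ = ((S i).card * (G' \ G).card + (S i).card * (G \ G').card) * B := by ring
    _ ≤ (d * G.card + d * G.card) * B := by gcongr
    _ = 2 * d * B * G.card := by ring

/-- The average over a fine grid of the second differences of a Lipschitz convex function. -/
theorem sum_grid_secondDiff_le {n : ℕ} {f : (Fin n → ℝ) → ℝ} {L : ℝ}
    (hf : ConvexOn ℝ Set.univ f) (hL : IsSubgradLipschitz f L)
    (x a : Fin n → ℝ) {r l : ℝ} (hl : 0 < l) (hlr : l ≤ r) :
    r * ∑ m ∈ gridIn x r a l, secondDiff f (n * l) (gridPoint a l m)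
      ≤ 2 * (n : ℝ) ^ 3 * l ^ 2 * L * (gridIn x r a l).card := by
  have hpt : ∀ (m : Fin n → ℤ) (i : Fin n),
      gridPoint a l (m + Pi.single i (n : ℤ)) = gridPoint a l m + Pi.single i (n * l) ∧
      gridPoint a l (m - Pi.single i (n : ℤ)) = gridPoint a l m - Pi.single i (n * l) := by
    intro m i
    constructor <;> ext j <;> by_cases hj : j = i
    · subst hj; simp [gridPoint]; ring
    · simp [gridPoint, hj]
    · subst hj; simp [gridPoint]; ring
    · simp [gridPoint, hj]
  have hdir : ∀ i : Fin n, r * ∑ m ∈ gridIn x r a l,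
      (f (gridPoint a l m + Pi.single i (n * l)) + f (gridPoint a l m - Pi.single i (n * l))
        - 2 * f (gridPoint a l m)) ≤ 2 * (n : ℝ) ^ 2 * l ^ 2 * L * (gridIn x r a l).card := by
    intro i
    have h := sum_box_second_difference_le (fun i => ⌈(x i - r - a i) / l⌉)
      (fun i => ⌊(x i + r - a i) / l⌋) (fun m => f (gridPoint a l m)) i n (B := L * (n * l)) (by
        intro m
        have h := abs_sub_le_of_isSubgradLipschitz hf hL (gridPoint a l m)
          (gridPoint a l (m - Pi.single i (n : ℤ)))
        rw [(hpt m i).2] at h ⊢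
        have hs : ∑ j, |gridPoint a l m j
            - (gridPoint a l m - Pi.single i ((n : ℝ) * l) : Fin n → ℝ) j| = n * l := by
          rw [Finset.sum_eq_single i]
          · simp [abs_of_pos hl]
          · intro j _ hj; simp [hj]
          · simp
        rwa [hs] at h)
    change _ * ∑ m ∈ gridIn x r a l, _ ≤ _ * ((gridIn x r a l).card : ℝ) at h
    simp only [hpt] at h
    set Q := ∑ m ∈ gridIn x r a l,
      (f (gridPoint a l m + Pi.single i (n * l)) + f (gridPoint a l m - Pi.single i (n * l))
        - 2 * f (gridPoint a l m)) with hQ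
    have hQ0 : 0 ≤ Q := by
      refine Finset.sum_nonneg fun m _ => ?_
      obtain ⟨g, hg⟩ := exists_isSubgradient hf (gridPoint a l m)
      have hp := hg (gridPoint a l m + Pi.single i (n * l))
      have hm := hg (gridPoint a l m - Pi.single i (n * l))
      simp [Pi.single_apply] at hp hm
      linarith
    -- A side of length `2r` holds at least `2r/l - 1` grid values, and `1 ≤ r/l`.
    have hK : r / l ≤ ((Finset.Icc ⌈(x i - r - a i) / l⌉ ⌊(x i + r - a i) / l⌋).card : ℝ) := by
      rw [Int.card_Icc]
      have h1 := Int.ceil_lt_add_one ((x i - r - a i) / l)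
      have h2 := Int.lt_floor_add_one ((x i + r - a i) / l)
      have h3 : (((⌊(x i + r - a i) / l⌋ + 1 - ⌈(x i - r - a i) / l⌉ : ℤ)) : ℝ)
          ≤ (((⌊(x i + r - a i) / l⌋ + 1 - ⌈(x i - r - a i) / l⌉).toNat : ℤ) : ℝ) := by
        exact_mod_cast Int.self_le_toNat _
      push_cast at h3
      have h4 : (x i + r - a i) / l - (x i - r - a i) / l = r / l + r / l := by
        field_simp; ring
      have h5 : 1 ≤ r / l := (one_le_div hl).2 hlr
      linarith
    have h6 : r / l * Q ≤ 2 * n * (L * (n * l)) * (gridIn x r a l).card :=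
      (mul_le_mul_of_nonneg_right hK hQ0).trans h
    calc r * Q = l * (r / l * Q) := by field_simp
      _ ≤ l * (2 * n * (L * (n * l)) * (gridIn x r a l).card) := by gcongr
      _ = _ := by ring
  simp only [secondDiff]
  rw [Finset.sum_comm, Finset.mul_sum]
  refine (Finset.sum_le_sum fun i _ => hdir i).trans_eq ?_
  rw [Finset.sum_const, Finset.card_univ, Fintype.card_fin, nsmul_eq_mul]
  ring

/-! ### Amplitudes of the gradient estimation circuit -/

theorem tensorPow_hadamard₂_zero (b : ℕ) (x : Fin b → Fin 2) :
    tensorPow b hadamard₂ x 0 = 1 / (Real.sqrt (2 ^ b) : ℂ) := by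
  have h : Real.sqrt (2 ^ b) = Real.sqrt 2 ^ b := by
    rw [Real.sqrt_eq_iff_mul_self_eq (by positivity) (by positivity), ← mul_pow,
      Real.mul_self_sqrt (by norm_num)]
  simp [tensorPow, hadamard₂, h]

theorem hadamardReg_zero (b : ℕ) (x : Fin (2 ^ b)) :
    hadamardReg b x ⟨0, by positivity⟩ = 1 / (Real.sqrt (2 ^ b) : ℂ) := by
  have h0 : finFunctionFinEquiv.symm (⟨0, by positivity⟩ : Fin (2 ^ b))
      = (0 : Fin b → Fin 2) := by
    ext i
    simp [finFunctionFinEquiv]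
  rw [hadamardReg, Matrix.reindex_apply, Matrix.submatrix_apply, h0, tensorPow_hadamard₂_zero]

/-- The state before the Fourier transforms, without the query: the uniform superposition. -/
theorem tensorPow_hadamardReg_zeroKet (n b : ℕ) (x : Reg n b) :
    (tensorPow n (hadamardReg b)).mulVec (zeroKet n b) x
      = (1 / (Real.sqrt (2 ^ b) : ℂ)) ^ n := by
  rw [zeroKet, Matrix.mulVec_single_one]
  simp only [tensorPow, Matrix.col_apply, hadamardReg_zero]
  simp

/-- The state after the query. -/
noncomputable def phaseState {n b : ℕ} (φ : Reg n b → ℝ) (x : Reg n b) : ℂ :=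
  Complex.exp (2 * Real.pi * Complex.I * (φ x : ℂ)) * (1 / (Real.sqrt (2 ^ b) : ℂ)) ^ n

theorem measureProb_eq {n b : ℕ} (φ : Reg n b → ℝ) (k : Reg n b) :
    measureProb φ k = ‖(tensorPow n (invQFT b)).mulVec (phaseState φ) k‖ ^ 2 := by
  simp only [measureProb, bornProb, runCircuit, gradientCircuit, List.foldl, applyGate]
  congr 4
  ext x
  rw [tensorPow_hadamardReg_zeroKet, phaseState]

theorem measureProb_nonneg {n b : ℕ} (φ : Reg n b → ℝ) (k : Reg n b) : 0 ≤ measureProb φ k := by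
  rw [measureProb_eq]; positivity

theorem sum_norm_sq_mulVec {ι : Type*} [Fintype ι] [DecidableEq ι] {U : Matrix ι ι ℂ}
    (hU : U ∈ Matrix.unitaryGroup ι ℂ) (v : ι → ℂ) :
    ∑ i, ‖U.mulVec v i‖ ^ 2 = ∑ i, ‖v i‖ ^ 2 := by
  have key : ∀ w : ι → ℂ, ((∑ i, ‖w i‖ ^ 2 : ℝ) : ℂ) = star w ⬝ᵥ w := by
    intro w
    simp only [dotProduct, Complex.ofReal_sum, Pi.star_apply, Complex.star_def]
    exact Finset.sum_congr rfl fun i _ => by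
      rw [mul_comm, Complex.mul_conj, Complex.normSq_eq_norm_sq]
  have h : ((∑ i, ‖U.mulVec v i‖ ^ 2 : ℝ) : ℂ) = ((∑ i, ‖v i‖ ^ 2 : ℝ) : ℂ) := by
    rw [key, key, Matrix.star_mulVec, Matrix.dotProduct_mulVec, Matrix.vecMul_vecMul,
      ← Matrix.star_eq_conjTranspose, Matrix.mem_unitaryGroup_iff'.1 hU, Matrix.vecMul_one]
  exact_mod_cast h

theorem norm_sq_amplitude (n b : ℕ) :
    ‖((1 / (Real.sqrt (2 ^ b) : ℂ)) ^ n : ℂ)‖ ^ 2 = 1 / ((2 : ℝ) ^ b) ^ n := by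
  rw [norm_pow, norm_div, norm_one, Complex.norm_real, Real.norm_eq_abs, abs_of_nonneg
    (Real.sqrt_nonneg _), ← pow_mul, mul_comm n 2, pow_mul, div_pow, Real.sq_sqrt (by positivity)]
  simp

theorem norm_exp_two_pi_I (t : ℝ) : ‖Complex.exp (2 * Real.pi * Complex.I * (t : ℂ))‖ = 1 := by
  have : 2 * Real.pi * Complex.I * (t : ℂ) = ((2 * Real.pi * t : ℝ) : ℂ) * Complex.I := by
    push_cast; ring
  rw [this, Complex.norm_exp_ofReal_mul_I]

theorem sum_measureProb {n b : ℕ} (φ : Reg n b → ℝ) : ∑ k, measureProb φ k = 1 := by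
  simp only [measureProb_eq]
  rw [sum_norm_sq_mulVec (tensorPow_mem n (invQFT_mem b))]
  simp only [phaseState, norm_mul, norm_exp_two_pi_I, one_mul, norm_sq_amplitude]
  simp

theorem norm_exp_sub_exp_le (s t : ℝ) :
    ‖Complex.exp (2 * Real.pi * Complex.I * (s : ℂ)) -
      Complex.exp (2 * Real.pi * Complex.I * (t : ℂ))‖ ≤ 2 * Real.pi * |s - t| := by
  have h : Complex.exp (2 * Real.pi * Complex.I * (s : ℂ)) -
      Complex.exp (2 * Real.pi * Complex.I * (t : ℂ))
      = Complex.exp (2 * Real.pi * Complex.I * (t : ℂ)) *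
        (Complex.exp (Complex.I * ((2 * Real.pi * (s - t) : ℝ) : ℂ)) - 1) := by
    rw [mul_sub, mul_one, ← Complex.exp_add]
    congr 2
    push_cast
    ring
  rw [h, norm_mul, norm_exp_two_pi_I, one_mul, Complex.norm_exp_I_mul_ofReal_sub_one,
    Real.norm_eq_abs, abs_mul, abs_two]
  have h1 := Real.abs_sin_le_abs (x := 2 * Real.pi * (s - t) / 2)
  rw [abs_div, abs_two, abs_mul, abs_of_pos (by positivity : 0 < 2 * Real.pi)] at h1
  linarith

/-- Phases that are close in the supremum norm lead to close final states. -/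
theorem sum_norm_sq_sub_le {n b : ℕ} {φ χ : Reg n b → ℝ} {η : ℝ} (h : ∀ u, |φ u - χ u| ≤ η) :
    ∑ k, ‖(tensorPow n (invQFT b)).mulVec (phaseState φ) k -
      (tensorPow n (invQFT b)).mulVec (phaseState χ) k‖ ^ 2 ≤ (2 * Real.pi * η) ^ 2 := by
  -- The final unitary preserves distances, so the states may be compared right after the query,
  -- where only phases differ.
  have h1 := sum_norm_sq_mulVec (tensorPow_mem n (invQFT_mem b)) (phaseState φ - phaseState χ)
  rw [Matrix.mulVec_sub] at h1
  simp only [Pi.sub_apply] at h1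
  rw [h1]
  calc ∑ u, ‖phaseState φ u - phaseState χ u‖ ^ 2
      ≤ ∑ _u : Reg n b, (2 * Real.pi * η) ^ 2 * (1 / ((2 : ℝ) ^ b) ^ n) := by
        refine Finset.sum_le_sum fun u _ => ?_
        rw [phaseState, phaseState, ← sub_mul, norm_mul, mul_pow, norm_sq_amplitude]
        gcongr
        exact (norm_exp_sub_exp_le _ _).trans (by gcongr; exact h u)
    _ = (2 * Real.pi * η) ^ 2 := by simp; field_simp

/-- The amplitude of the outcome `y` for one register with the linear phase `κ γ(x) / N`. -/
noncomputable def linearAmplitude (b : ℕ) (κ : ℝ) (y : Fin (2 ^ b)) : ℂ :=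
  ∑ x, invQFT b y x * (Complex.exp (2 * Real.pi * Complex.I * ((gam b x * κ / 2 ^ b : ℝ) : ℂ))
    * (1 / (Real.sqrt (2 ^ b) : ℂ)))

/-- A linear phase leaves a product state, so the registers can be treated one at a time; the
constant `c` is a global phase. -/
theorem mulVec_phaseState_linear {n b : ℕ} (c : ℝ) (κ : Fin n → ℝ) (k : Reg n b) :
    (tensorPow n (invQFT b)).mulVec (phaseState fun u => c + ∑ i, gam b (u i) * κ i / 2 ^ b) k
      = Complex.exp (2 * Real.pi * Complex.I * (c : ℂ)) * ∏ i, linearAmplitude b (κ i) (k i) := by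
  simp only [linearAmplitude]
  rw [Finset.prod_univ_sum, Fintype.piFinset_univ, Finset.mul_sum, Matrix.mulVec, dotProduct]
  refine Finset.sum_congr rfl fun u _ => ?_
  rw [Finset.prod_mul_distrib, Finset.prod_mul_distrib, ← Complex.exp_sum, phaseState,
    Complex.ofReal_add, mul_add, Complex.exp_add, Complex.ofReal_sum, Finset.mul_sum]
  simp only [tensorPow, Finset.prod_const, Finset.card_univ, Fintype.card_fin]
  ring

theorem sum_norm_sq_linearAmplitude (b : ℕ) (κ : ℝ) : ∑ y, ‖linearAmplitude b κ y‖ ^ 2 = 1 := by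
  have h := sum_norm_sq_mulVec (invQFT_mem b) fun x =>
    Complex.exp (2 * Real.pi * Complex.I * ((gam b x * κ / 2 ^ b : ℝ) : ℂ))
      * (1 / (Real.sqrt (2 ^ b) : ℂ))
  have h2 : ∀ x : Fin (2 ^ b),
      ‖Complex.exp (2 * Real.pi * Complex.I * ((gam b x * κ / 2 ^ b : ℝ) : ℂ))
        * (1 / (Real.sqrt (2 ^ b) : ℂ))‖ ^ 2 = 1 / 2 ^ b := by
    intro x
    rw [norm_mul, norm_exp_two_pi_I, one_mul]
    simp
  simp only [h2] at h
  simpa [Matrix.mulVec, dotProduct, linearAmplitude] using h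

/-- The amplitude is a geometric sum with ratio `z` on the unit circle: `|z^N - 1| ≤ 2`, while `|z -
1|` is twice the sine. The product form avoids division when the sine vanishes. -/
theorem norm_linearAmplitude_mul_le (b : ℕ) (κ : ℝ) (y : Fin (2 ^ b)) :
    ‖linearAmplitude b κ y‖ * (2 ^ b * |Real.sin (Real.pi * (gam b y - κ) / 2 ^ b)|) ≤ 1 := by
  have hN : (0 : ℝ) < 2 ^ b := by positivity
  have hs : ((Real.sqrt (2 ^ b) : ℝ) : ℂ) * ((Real.sqrt (2 ^ b) : ℝ) : ℂ) = 2 ^ b := by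
    rw [← Complex.ofReal_mul, Real.mul_self_sqrt hN.le]
    push_cast
    rfl
  set θ : ℝ := 2 * (Real.pi * (κ - gam b y) / 2 ^ b) with hθ
  set z := Complex.exp (Complex.I * (θ : ℂ)) with hz
  have hterm : ∀ x : Fin (2 ^ b), invQFT b y x *
      (Complex.exp (2 * Real.pi * Complex.I * ((gam b x * κ / 2 ^ b : ℝ) : ℂ))
        * (1 / (Real.sqrt (2 ^ b) : ℂ)))
      = Complex.exp (Complex.I * ((-(θ * 2 ^ b / 2) : ℝ) : ℂ)) / 2 ^ b * z ^ (x : ℕ) := by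
    intro x
    rw [invQFT, hz, ← Complex.exp_nat_mul, div_mul_eq_mul_div, mul_one_div, mul_div_assoc',
      div_div, hs, ← Complex.exp_add, div_mul_eq_mul_div, ← Complex.exp_add]
    congr 2
    rw [hθ]
    simp only [gam]
    push_cast
    field_simp
    ring
  have hsum : linearAmplitude b κ y = Complex.exp (Complex.I * ((-(θ * 2 ^ b / 2) : ℝ) : ℂ)) / 2 ^ b
      * ∑ x ∈ Finset.range (2 ^ b), z ^ x := by
    rw [linearAmplitude, Finset.sum_congr rfl fun x _ => hterm x, ← Finset.mul_sum,
      Fin.sum_univ_eq_sum_range (fun x => z ^ x)]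
  have hz1 : ‖z - 1‖ = 2 * |Real.sin (Real.pi * (gam b y - κ) / 2 ^ b)| := by
    rw [hz, Complex.norm_exp_I_mul_ofReal_sub_one, Real.norm_eq_abs, abs_mul, abs_two, hθ,
      ← abs_neg (Real.sin (Real.pi * (gam b y - κ) / 2 ^ b)), ← Real.sin_neg]
    congr 3
    ring
  have hzN : ‖z ^ 2 ^ b - 1‖ ≤ 2 := by
    refine (norm_sub_le _ _).trans ?_
    rw [norm_pow, hz, mul_comm, Complex.norm_exp_ofReal_mul_I]
    norm_num
  have hgeom := geom_sum_mul z (2 ^ b)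
  have hphase : ‖Complex.exp (Complex.I * ((-(θ * 2 ^ b / 2) : ℝ) : ℂ)) / 2 ^ b‖ = 1 / 2 ^ b := by
    rw [norm_div, mul_comm, Complex.norm_exp_ofReal_mul_I]
    simp
  have hn : ‖∑ x ∈ Finset.range (2 ^ b), z ^ x‖ * ‖z - 1‖ ≤ 2 := by
    rw [← norm_mul, hgeom]; exact hzN
  rw [hsum, norm_mul, hphase]
  rw [hz1] at hn
  calc _ = ‖∑ x ∈ Finset.range (2 ^ b), z ^ x‖ *
        (2 * |Real.sin (Real.pi * (gam b y - κ) / 2 ^ b)|) / 2 := by field_simp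
    _ ≤ 1 := by linarith

/-! ### Tails of the Fourier sampling distribution -/

theorem cot_sub_cot {a b : ℝ} (ha : Real.sin a ≠ 0) (hb : Real.sin b ≠ 0) :
    Real.cot a - Real.cot b = Real.sin (b - a) / (Real.sin a * Real.sin b) := by
  rw [Real.cot_eq_cos_div_sin, Real.cot_eq_cos_div_sin, Real.sin_sub]
  field_simp

theorem cot_antitoneOn {a b : ℝ} (ha : 0 < a) (hab : a ≤ b) (hb : b < Real.pi) :
    Real.cot b ≤ Real.cot a := by
  have h1 := Real.sin_pos_of_pos_of_lt_pi ha (hab.trans_lt hb)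
  have h2 := Real.sin_pos_of_pos_of_lt_pi (ha.trans_le hab) hb
  rw [← sub_nonneg, cot_sub_cot h1.ne' h2.ne']
  exact div_nonneg (Real.sin_nonneg_of_nonneg_of_le_pi (by linarith) (by linarith)) (by positivity)

theorem cot_le_inv {a : ℝ} (ha : 0 < a) (ha' : a < Real.pi / 2) : Real.cot a ≤ a⁻¹ := by
  rw [← Real.tan_inv_eq_cot]
  exact inv_anti₀ ha (Real.lt_tan ha ha').le

/-- A discrete form of `-cot' = 1/sin²`, made for telescoping. It rests on `sin (x-h) sin (x+h) =
sin² x - sin² h`. -/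
theorem inv_sin_sq_le {x h : ℝ} (hh : 0 < h) (h1 : h < x) (h2 : x + h < Real.pi) :
    (Real.sin x ^ 2)⁻¹ ≤ (Real.cot (x - h) - Real.cot (x + h)) / Real.sin (2 * h) := by
  have ha : 0 < Real.sin (x - h) := Real.sin_pos_of_pos_of_lt_pi (by linarith) (by linarith)
  have hb : 0 < Real.sin (x + h) := Real.sin_pos_of_pos_of_lt_pi (by linarith) (by linarith)
  have hc : 0 < Real.sin (2 * h) := Real.sin_pos_of_pos_of_lt_pi (by linarith) (by linarith)
  rw [cot_sub_cot ha.ne' hb.ne', show x + h - (x - h) = 2 * h by ring, div_div_cancel_left' hc.ne']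
  refine inv_anti₀ (by positivity) ?_
  rw [Real.sin_sub, Real.sin_add]
  nlinarith [Real.sin_sq_add_cos_sq x, Real.sin_sq_add_cos_sq h, sq_nonneg (Real.sin h)]

theorem sum_tail_inv_sin_sq_le {N : ℕ} (hN : 16 ≤ N) {σ : ℝ} (hσ : σ ≤ 1 - N / 4) :
    ∑ j ∈ Finset.range N, (if 497 / 100 < j + σ then
        (Real.sin (Real.pi * (j + σ) / N) ^ 2)⁻¹ else 0)
      ≤ (N / (447 / 100 * Real.pi) + 32 / (7 * Real.pi)) / Real.sin (Real.pi / N) := by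
  have hN' : (16 : ℝ) ≤ N := by exact_mod_cast hN
  have hpi := Real.pi_pos
  have hN0 : (0 : ℝ) < N := by linarith
  -- The step is `h = π/(2N)`, and `447/100 = 497/100 - 1/2`. Clamping the argument makes terms
  -- below the threshold nonnegative, so the telescoping can run over all `j`. Arguments stay below
  -- `25/32 N` because `3N/4 + 1/2 ≤ 25/32 N` for `N ≥ 16`.
  set Φ : ℝ → ℝ := fun t => Real.cot (Real.pi * max t (447 / 100) / N) with hΦ
  have hs : 0 < Real.sin (Real.pi / N) := by
    refine Real.sin_pos_of_pos_of_lt_pi (by positivity) ?_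
    rw [div_lt_iff₀ hN0]; nlinarith
  have htop : ∀ j ∈ Finset.range N, (j : ℝ) + σ + 1 / 2 ≤ 25 / 32 * N := by
    intro j hj
    have : (j : ℝ) + 1 ≤ N := by exact_mod_cast Finset.mem_range.1 hj
    linarith
  have hanti : ∀ s t : ℝ, s ≤ t → t ≤ 25 / 32 * N → Φ t ≤ Φ s := by
    intro s t hst ht
    refine cot_antitoneOn (div_pos (mul_pos hpi (lt_max_of_lt_right (by norm_num))) hN0)
      (by gcongr) ?_
    rw [div_lt_iff₀ hN0]
    have : max t (447 / 100) < N := max_lt (by linarith) (by linarith)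
    gcongr
  have hterm : ∀ j ∈ Finset.range N, (if 497 / 100 < (j : ℝ) + σ then
        (Real.sin (Real.pi * (j + σ) / N) ^ 2)⁻¹ else 0)
      ≤ (Φ (j + σ - 1 / 2) - Φ ((j + 1 : ℕ) + σ - 1 / 2)) / Real.sin (Real.pi / N) := by
    intro j hj
    have e : ((j + 1 : ℕ) : ℝ) + σ - 1 / 2 = j + σ + 1 / 2 := by push_cast; ring
    rw [e]
    split_ifs with hw
    · have h1 : Φ (j + σ - 1 / 2) = Real.cot (Real.pi * (j + σ) / N - Real.pi / (2 * N)) := by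
        simp only [hΦ]
        rw [max_eq_left (by linarith)]
        congr 1
        field_simp
      have h2 : Φ (j + σ + 1 / 2) = Real.cot (Real.pi * (j + σ) / N + Real.pi / (2 * N)) := by
        simp only [hΦ]
        rw [max_eq_left (by linarith)]
        congr 1
        field_simp
      have h3 : Real.pi / N = 2 * (Real.pi / (2 * N)) := by field_simp
      rw [h1, h2, h3]
      have h4 : Real.pi * (j + σ) / N - Real.pi / (2 * N) = Real.pi * (j + σ - 1 / 2) / N := by
        field_simp
      have h5 : Real.pi * (j + σ) / N + Real.pi / (2 * N) = Real.pi * (j + σ + 1 / 2) / N := by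
        field_simp
      refine inv_sin_sq_le (by positivity) ?_ ?_
      · rw [← sub_pos, h4]
        exact div_pos (mul_pos hpi (by linarith)) hN0
      · rw [h5, div_lt_iff₀ hN0]
        have := htop j hj
        gcongr
        linarith
    · exact div_nonneg (sub_nonneg.2 (hanti _ _ (by linarith) (htop j hj))) hs.le
  refine (Finset.sum_le_sum hterm).trans ?_
  rw [← Finset.sum_div]
  gcongr
  rw [Finset.sum_range_sub' (fun j : ℕ => Φ (j + σ - 1 / 2))]
  have hfirst : Φ ((0 : ℕ) + σ - 1 / 2) ≤ N / (447 / 100 * Real.pi) := by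
    have h1 : Φ ((0 : ℕ) + σ - 1 / 2) = Real.cot (Real.pi * (447 / 100) / N) := by
      simp only [hΦ]
      rw [max_eq_right]
      push_cast
      linarith
    rw [h1]
    refine (cot_le_inv (by positivity) ?_).trans_eq ?_
    · rw [div_lt_iff₀ hN0]; nlinarith
    · rw [inv_div]; ring
  have hlast : -(32 / (7 * Real.pi)) ≤ Φ (N + σ - 1 / 2) := by
    have h1 : Φ (25 / 32 * N) ≤ Φ (N + σ - 1 / 2) := hanti _ _ (by linarith) le_rfl
    have h2 : Φ (25 / 32 * N) = -Real.cot (7 / 32 * Real.pi) := by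
      simp only [hΦ]
      rw [max_eq_left (by linarith),
        show Real.pi * (25 / 32 * N) / N = Real.pi - 7 / 32 * Real.pi by field_simp; norm_num,
        Real.cot_eq_cos_div_sin, Real.cot_eq_cos_div_sin, Real.cos_pi_sub, Real.sin_pi_sub, neg_div]
    have h3 : Real.cot (7 / 32 * Real.pi) ≤ (7 / 32 * Real.pi)⁻¹ :=
      cot_le_inv (by positivity) (by linarith)
    have h4 : (7 / 32 * Real.pi)⁻¹ = 32 / (7 * Real.pi) := by field_simp
    linarith
  linarith

/-- The leading `2` counts the two tails. Once the sine is replaced by `0.993` times its argument,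
the inequality is linear in `N` and tightest at `N = 16`. -/
theorem tail_constant_le {N : ℝ} (hN : 16 ≤ N) :
    2 * ((N / (447 / 100 * Real.pi) + 32 / (7 * Real.pi)) / Real.sin (Real.pi / N)) / N ^ 2
      ≤ 27 / 250 := by
  have hpi := Real.pi_gt_d4
  have hpi' := Real.pi_lt_d4
  have hN0 : 0 < N := by linarith
  have hx : Real.pi / N ≤ 1 / 5 := by rw [div_le_iff₀ hN0]; linarith
  have hx0 : 0 < Real.pi / N := by positivity
  have hs : 993 / 1000 * (Real.pi / N) ≤ Real.sin (Real.pi / N) := by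
    have h := Real.sin_gt_sub_cube hx0
    have h2 : (Real.pi / N) ^ 3 ≤ (1 / 5) ^ 2 * (Real.pi / N) := by
      rw [pow_succ]; gcongr
    linarith
  have hs0 : 0 < Real.sin (Real.pi / N) := lt_of_lt_of_le (by positivity) hs
  rw [div_le_iff₀ (by positivity), ← mul_div_assoc, div_le_iff₀ hs0]
  have h1 : 27 / 250 * N ^ 2 * (993 / 1000 * (Real.pi / N)) ≤
      27 / 250 * N ^ 2 * Real.sin (Real.pi / N) := by gcongr
  refine le_trans ?_ h1
  have h2 : 27 / 250 * N ^ 2 * (993 / 1000 * (Real.pi / N)) = 27 / 250 * (993 / 1000) * N * Real.pi := by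
    field_simp
  have h3 : 2 * (N / (447 / 100 * Real.pi) + 32 / (7 * Real.pi))
      = (200 / 447 * N + 64 / 7) / Real.pi := by field_simp; ring
  rw [h2, h3, div_le_iff₀ (by positivity)]
  have h4 : 9.869 ≤ Real.pi * Real.pi := by nlinarith
  nlinarith

/-- Fourier sampling of a linear phase: the outcome is more than `4.97` away from the frequency with
probability at most `0.108`. -/
theorem sum_norm_sq_linearAmplitude_tail {b : ℕ} (hb : 4 ≤ b) {κ : ℝ} (hκ : |κ| ≤ 2 ^ b / 4) :
    ∑ y with 497 / 100 < |gam b y - κ|, ‖linearAmplitude b κ y‖ ^ 2 ≤ 27 / 250 := by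
  have hN : 16 ≤ 2 ^ b := (Nat.pow_le_pow_right (by norm_num) hb : 2 ^ 4 ≤ 2 ^ b)
  have hN' : (16 : ℝ) ≤ 2 ^ b := by exact_mod_cast hN
  rw [abs_le] at hκ
  -- `σ` serves the right tail; `σ'` serves the left one, read with the register reversed. The extra
  -- `1` in `σ'` reflects that `G` ends at `N/2 - 1`.
  set σ : ℝ := -(2 ^ b) / 2 - κ with hσ
  set σ' : ℝ := -(2 ^ b) / 2 + 1 + κ with hσ'
  have hr := sum_tail_inv_sin_sq_le hN (σ := σ) (by push_cast; rw [hσ]; linarith)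
  have hl := sum_tail_inv_sin_sq_le hN (σ := σ') (by push_cast; rw [hσ']; linarith)
  set F : ℝ → ℝ := fun t => if 497 / 100 < t then (Real.sin (Real.pi * t / 2 ^ b) ^ 2)⁻¹ else 0
    with hF
  have hF0 : ∀ t, 0 ≤ F t := by
    intro t
    simp only [hF]
    split_ifs <;> positivity
  have hterm : ∀ y : Fin (2 ^ b), (if 497 / 100 < |gam b y - κ| then ‖linearAmplitude b κ y‖ ^ 2
      else 0) ≤ (F ((y : ℕ) + σ) + F ((2 ^ b - 1 - (y : ℕ) : ℕ) + σ')) / (2 ^ b) ^ 2 := by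
    intro y
    have hy : (y : ℝ) + 1 ≤ 2 ^ b := by exact_mod_cast y.isLt
    have e1 : ((y : ℕ) : ℝ) + σ = gam b y - κ := by rw [hσ, gam]; ring
    have e2 : ((2 ^ b - 1 - (y : ℕ) : ℕ) : ℝ) + σ' = -(gam b y - κ) := by
      rw [Nat.cast_sub (by have := y.isLt; omega), Nat.cast_sub (by omega), hσ', gam]
      push_cast
      ring
    rw [e1, e2]
    split_ifs with hw
    · have hnorm := norm_linearAmplitude_mul_le b κ y
      have hgam : |gam b y - κ| < 2 ^ b := by
        rw [abs_lt, gam]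
        have : (0 : ℝ) ≤ y := Nat.cast_nonneg _
        constructor <;> linarith
      have hsin : (Real.sin (Real.pi * |gam b y - κ| / 2 ^ b) ^ 2)⁻¹
          ≤ F (gam b y - κ) + F (-(gam b y - κ)) := by
        rcases le_total 0 (gam b y - κ) with h | h
        · have := hF0 (-(gam b y - κ))
          rw [abs_of_nonneg h] at hw ⊢
          have : F (gam b y - κ) = (Real.sin (Real.pi * (gam b y - κ) / 2 ^ b) ^ 2)⁻¹ := if_pos hw
          linarith
        · have := hF0 (gam b y - κ)
          rw [abs_of_nonpos h] at hw ⊢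
          have : F (-(gam b y - κ)) = (Real.sin (Real.pi * -(gam b y - κ) / 2 ^ b) ^ 2)⁻¹ :=
            if_pos hw
          linarith
      have hsq : Real.sin (Real.pi * |gam b y - κ| / 2 ^ b) ^ 2
          = |Real.sin (Real.pi * (gam b y - κ) / 2 ^ b)| ^ 2 := by
        rw [sq_abs]
        rcases abs_choice (gam b y - κ) with h | h <;> rw [h]
        rw [mul_neg, neg_div, Real.sin_neg, neg_sq]
      have hpos : 0 < Real.sin (Real.pi * |gam b y - κ| / 2 ^ b) := by
        refine Real.sin_pos_of_pos_of_lt_pi (by have := Real.pi_pos; positivity) ?_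
        rw [div_lt_iff₀ (by positivity)]
        have := Real.pi_pos
        gcongr
      refine le_trans ?_ (div_le_div_of_nonneg_right hsin (by positivity))
      have h1 : (‖linearAmplitude b κ y‖ * (2 ^ b * |Real.sin (Real.pi * (gam b y - κ) / 2 ^ b)|)) ^ 2
          ≤ 1 := pow_le_one₀ (by positivity) hnorm
      rw [mul_pow, mul_pow, ← hsq] at h1
      rw [le_div_iff₀ (by positivity), ← one_div, le_div_iff₀ (by positivity)]
      linarith
    · exact div_nonneg (add_nonneg (hF0 _) (hF0 _)) (by positivity)
  rw [Finset.sum_filter]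
  refine (Finset.sum_le_sum fun y _ => hterm y).trans ?_
  rw [← Finset.sum_div, Finset.sum_add_distrib,
    Fin.sum_univ_eq_sum_range (fun y => F ((y : ℝ) + σ)),
    Fin.sum_univ_eq_sum_range (fun y => F ((2 ^ b - 1 - y : ℕ) + σ')),
    Finset.sum_range_reflect (fun y => F ((y : ℝ) + σ'))]
  push_cast at hr hl
  refine le_trans ?_ (tail_constant_le hN')
  gcongr
  rw [two_mul]
  exact add_le_add hr hl

/-! ### One run of the gradient estimation -/

/-- Young's inequality, weighted so that the tail `0.108` and the phase noise `7/160` together give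
`9/8 · 0.108 + 9 (7/160)² ≤ 0.14`. -/
theorem norm_sq_le_add (z w : ℂ) : ‖z‖ ^ 2 ≤ 9 / 8 * ‖w‖ ^ 2 + 9 * ‖z - w‖ ^ 2 := by
  have h : ‖z‖ ≤ ‖w‖ + ‖z - w‖ := by simpa using norm_add_le w (z - w)
  nlinarith [norm_nonneg z, norm_nonneg w, norm_nonneg (z - w), sq_nonneg (‖w‖ - 8 * ‖z - w‖)]

/-- If the phase is nearly linear, then in each coordinate one measurement is far from the
frequency with probability at most `0.14`. -/
theorem sum_measureProb_far_le {n b : ℕ} (hb : 4 ≤ b) {φ : Reg n b → ℝ} {c η : ℝ} {κ : Fin n → ℝ}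
    (hκ : ∀ i, |κ i| ≤ 2 ^ b / 4) (hφ : ∀ u, |φ u - (c + ∑ i, gam b (u i) * κ i / 2 ^ b)| ≤ η)
    (hη : 2 * Real.pi * η ≤ 7 / 160) (i : Fin n) {w : ℝ} (hw : 497 / 100 ≤ w) :
    ∑ k with w < |gam b (k i) - κ i|, measureProb φ k ≤ 7 / 50 := by
  have hη0 : 0 ≤ η := (abs_nonneg _).trans (hφ fun _ => ⟨0, by positivity⟩)
  set χ : Reg n b → ℝ := fun u => c + ∑ i, gam b (u i) * κ i / 2 ^ b with hχ
  set S : Finset (Fin (2 ^ b)) := Finset.univ.filter fun y => 497 / 100 < |gam b y - κ i| with hS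
  have hideal : ∑ k with 497 / 100 < |gam b (k i) - κ i|,
      ‖(tensorPow n (invQFT b)).mulVec (phaseState χ) k‖ ^ 2 ≤ 27 / 250 := by
    -- The event constrains only register `i`; in the product distribution the other registers
    -- contribute a factor one.
    have hset : (Finset.univ.filter fun k : Reg n b => 497 / 100 < |gam b (k i) - κ i|)
        = Fintype.piFinset (Function.update (fun _ => Finset.univ) i S) := by
      ext k
      simp only [Finset.mem_filter, Finset.mem_univ, true_and, Fintype.mem_piFinset]
      constructor
      · intro h j
        by_cases hj : j = i
        · subst hj; simpa [hS] using h
        · simp [hj]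
      · intro h
        simpa [hS] using h i
    have hprod : ∀ k, ‖(tensorPow n (invQFT b)).mulVec (phaseState χ) k‖ ^ 2
        = ∏ j, ‖linearAmplitude b (κ j) (k j)‖ ^ 2 := by
      intro k
      rw [hχ, mulVec_phaseState_linear, norm_mul, norm_exp_two_pi_I, one_mul, norm_prod,
        Finset.prod_pow]
    simp only [hprod]
    rw [hset, ← Finset.prod_univ_sum (f := fun j y => ‖linearAmplitude b (κ j) y‖ ^ 2), ← Finset.mul_prod_erase _ _ (Finset.mem_univ i),
      Function.update_self, Finset.prod_eq_one fun j hj => ?_, mul_one]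
    · exact sum_norm_sq_linearAmplitude_tail hb (hκ i)
    · rw [Function.update_of_ne (Finset.ne_of_mem_erase hj)]
      exact sum_norm_sq_linearAmplitude b (κ j)
  have hnoise := sum_norm_sq_sub_le (χ := χ) hφ
  calc ∑ k with w < |gam b (k i) - κ i|, measureProb φ k
      ≤ ∑ k with 497 / 100 < |gam b (k i) - κ i|, measureProb φ k := by
        refine Finset.sum_le_sum_of_subset_of_nonneg (fun k hk => ?_)
          fun _ _ _ => measureProb_nonneg _ _
        simp only [Finset.mem_filter] at hk ⊢
        exact ⟨hk.1, hw.trans_lt hk.2⟩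
    _ ≤ ∑ k with 497 / 100 < |gam b (k i) - κ i|,
        (9 / 8 * ‖(tensorPow n (invQFT b)).mulVec (phaseState χ) k‖ ^ 2 +
          9 * ‖(tensorPow n (invQFT b)).mulVec (phaseState φ) k -
            (tensorPow n (invQFT b)).mulVec (phaseState χ) k‖ ^ 2) :=
        Finset.sum_le_sum fun k _ => by rw [measureProb_eq]; exact norm_sq_le_add _ _
    _ ≤ 9 / 8 * (27 / 250) + 9 * (2 * Real.pi * η) ^ 2 := by
        rw [Finset.sum_add_distrib, ← Finset.mul_sum, ← Finset.mul_sum]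
        gcongr
        exact (Finset.sum_le_univ_sum_of_nonneg fun _ => by positivity).trans hnoise
    _ ≤ 9 / 8 * (27 / 250) + 9 * (7 / 160) ^ 2 := by gcongr
    _ ≤ 7 / 50 := by norm_num

/-! ### Majority median and amplification -/

/-- Each side of a median holds at least half of `S`, hence more than the exceptional set `B`. So
the median lies between two unexceptional values. -/
theorem IsMedian.exists_le_ge {T : ℕ} {S B : Finset (Fin T)} {e : Fin T → ℝ} {m : ℝ}
    (hm : IsMedian S e m) (hB : 2 * B.card < S.card) :
    (∃ t ∈ S, t ∉ B ∧ e t ≤ m) ∧ ∃ t ∈ S, t ∉ B ∧ m ≤ e t := by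
  have key : ∀ (p : Fin T → Prop) [DecidablePred p], S.card ≤ 2 * (S.filter p).card →
      ∃ t ∈ S, t ∉ B ∧ p t := by
    intro p _ h
    obtain ⟨t, ht, htB⟩ := Finset.exists_mem_notMem_of_card_lt_card
      (s := B) (t := S.filter p) (by omega)
    rw [Finset.mem_filter] at ht
    exact ⟨t, ht.1, htB, ht.2⟩
  exact ⟨key _ hm.1, key _ hm.2⟩

/-- The combined value is no larger than the values that enter it. -/
theorem IsMajorityMedian.abs_le {T : ℕ} {w : ℝ} {e : Fin T → ℝ} {m C : ℝ}
    (hm : IsMajorityMedian w e m) (hC : 0 ≤ C) (he : ∀ t, |e t| ≤ C) : |m| ≤ C := by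
  rcases hm with ⟨a, ha, hmed⟩ | ⟨_, h0⟩
  · obtain ⟨⟨t, _, _, ht⟩, ⟨u, _, _, hu⟩⟩ := hmed.exists_le_ge (B := ∅) (by rw [Finset.card_empty]; omega)
    exact _root_.abs_le.2 ⟨(_root_.abs_le.1 (he t)).1.trans ht, hu.trans (_root_.abs_le.1 (he u)).2⟩
  · simpa [h0] using hC

/-- If fewer than a quarter of the values are farther than `r` from `g`, the combined value is within
`r` of `g`. -/
theorem IsMajorityMedian.abs_sub_le {T : ℕ} {r : ℝ} {e : Fin T → ℝ} {m g : ℝ}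
    (hm : IsMajorityMedian (2 * r) e m) (hB : 4 * (Finset.univ.filter fun t => r < |e t - g|).card < T) :
    |m - g| ≤ r := by
  set B := Finset.univ.filter fun t => r < |e t - g| with hBdef
  have hgood : ∀ t, t ∉ B → |e t - g| ≤ r := by
    intro t ht
    simpa [hBdef] using ht
  rcases hm with ⟨a, ha, hmed⟩ | ⟨hno, _⟩
  · obtain ⟨⟨t, _, htB, ht⟩, ⟨u, _, huB, hu⟩⟩ := hmed.exists_le_ge (B := B) (by omega)
    have h1 := _root_.abs_le.1 (hgood t htB)
    have h2 := _root_.abs_le.1 (hgood u huB)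
    exact _root_.abs_le.2 ⟨by linarith, by linarith⟩
  -- The default value `0` cannot occur: `[g - r, g + r]` has width `2 r` and contains more than
  -- three quarters of the values.
  · refine absurd ⟨g - r, ?_⟩ hno
    have hsub : Bᶜ ⊆ inInterval e (g - r) (2 * r) := by
      intro t ht
      have h := _root_.abs_le.1 (hgood t (Finset.mem_compl.1 ht))
      simp only [inInterval, Finset.mem_filter, Finset.mem_univ, true_and]
      constructor <;> linarith
    have h1 := Finset.card_le_card hsub
    have h2 : Bᶜ.card = T - B.card := by rw [Finset.card_compl, Fintype.card_fin]
    omega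

/-- The left side bounds the mean of `q^(4·bad - 1)` for one trial; `q = 1.19` is close to the
minimizer. Taking 24th powers reduces the claim to a decimal bound for `e`. -/
theorem chernoff_base_le : (119 / 100 : ℝ)⁻¹ * (1 + 7 / 50 * ((119 / 100) ^ 4 - 1))
    ≤ Real.exp (-1 / 24) := by
  have h : ((119 / 100 : ℝ)⁻¹ * (1 + 7 / 50 * ((119 / 100) ^ 4 - 1))) ^ 24
      ≤ Real.exp (-1 / 24) ^ 24 := by
    rw [← Real.exp_nat_mul]
    have e1 : ((24 : ℕ) : ℝ) * (-1 / 24) = -1 := by norm_num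
    rw [e1, Real.exp_neg]
    have h2 : (2.7182818286 : ℝ)⁻¹ ≤ (Real.exp 1)⁻¹ :=
      inv_anti₀ (Real.exp_pos _) Real.exp_one_lt_d9.le
    refine le_trans ?_ h2
    norm_num
  exact le_of_pow_le_pow_left₀ (by norm_num) (Real.exp_pos _).le h

/-- In `T` independent trials with failure probability at most `0.14`, a quarter of the trials fails
with probability at most `exp (-T/24)`. -/
theorem sum_prod_quarter_le {ι : Type*} [Fintype ι] (T : ℕ) {P : ι → ℝ} (hP : ∀ k, 0 ≤ P k)
    (hP1 : ∑ k, P k = 1) (bad : ι → Prop) [DecidablePred bad]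
    (hbad : ∑ k with bad k, P k ≤ 7 / 50) :
    ∑ k : Fin T → ι with T ≤ 4 * (Finset.univ.filter fun t => bad (k t)).card, ∏ t, P (k t)
      ≤ Real.exp (-(T : ℝ) / 24) := by
  set q : ℝ := 119 / 100 with hq
  have hq1 : 1 ≤ q := by norm_num [hq]
  -- Exponential Markov inequality: the tilting factor `q^(4·#bad - T)` is at least one on the
  -- event, and it factors over the trials.
  set W : ι → ℝ := fun k => q⁻¹ * (P k * if bad k then q ^ 4 else 1) with hW
  have hW0 : ∀ k, 0 ≤ W k := by
    intro k
    have := hP k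
    simp only [hW]
    split_ifs <;> positivity
  have hWsum : ∑ k, W k ≤ Real.exp (-1 / 24) := by
    refine le_trans ?_ chernoff_base_le
    have h1 : ∀ k, (P k * if bad k then q ^ 4 else 1)
        = P k + (q ^ 4 - 1) * if bad k then P k else 0 := by
      intro k
      split_ifs <;> ring
    simp only [hW, h1]
    rw [← Finset.mul_sum, Finset.sum_add_distrib, ← Finset.mul_sum, hP1, ← Finset.sum_filter]
    have h2 : (0 : ℝ) ≤ q ^ 4 - 1 := by norm_num [hq]
    have h3 := mul_le_mul_of_nonneg_left hbad h2
    exact mul_le_mul_of_nonneg_left (by linarith) (by positivity)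
  have hterm : ∀ k : Fin T → ι, (if T ≤ 4 * (Finset.univ.filter fun t => bad (k t)).card then
      ∏ t, P (k t) else 0) ≤ ∏ t, W (k t) := by
    intro k
    split_ifs with h
    · have e : ∏ t, W (k t) = (q⁻¹ ^ T * q ^ (4 * (Finset.univ.filter fun t => bad (k t)).card))
          * ∏ t, P (k t) := by
        simp only [hW]
        rw [Finset.prod_mul_distrib, Finset.prod_mul_distrib, Finset.prod_ite, pow_mul]
        simp
        ring
      rw [e]
      refine le_mul_of_one_le_left (Finset.prod_nonneg fun t _ => hP _) ?_
      rw [inv_pow, ← div_eq_inv_mul, one_le_div (by positivity)]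
      exact pow_le_pow_right₀ hq1 h
    · exact Finset.prod_nonneg fun t _ => hW0 _
  rw [Finset.sum_filter]
  refine (Finset.sum_le_sum fun k _ => hterm k).trans ?_
  rw [← Fintype.sum_pow]
  refine (pow_le_pow_left₀ (Finset.sum_nonneg fun k _ => hW0 k) hWsum T).trans_eq ?_
  rw [← Real.exp_nat_mul]
  congr 1
  ring

theorem sum_prod_eq_one {ι : Type*} [Fintype ι] (T : ℕ) {P : ι → ℝ} (hP1 : ∑ k, P k = 1) :
    ∑ k : Fin T → ι, ∏ t, P (k t) = 1 := by
  rw [← Fintype.sum_pow, hP1, one_pow]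

theorem abs_estimate_le {n b : ℕ} {L : ℝ} (hL : 0 ≤ L) (k : Reg n b) (i : Fin n) :
    |estimate L k i| ≤ L := by
  have hN : (0 : ℝ) < 2 ^ b := by positivity
  have h1 : (k i : ℝ) + 1 ≤ 2 ^ b := by exact_mod_cast (k i).isLt
  have h0 : (0 : ℝ) ≤ (k i : ℕ) := Nat.cast_nonneg _
  have hg : |gam b (k i)| ≤ 2 ^ b / 2 := by rw [abs_le, gam]; constructor <;> linarith
  rw [estimate, abs_mul, abs_of_nonneg (by positivity)]
  calc 2 * L / 2 ^ b * |gam b (k i)| ≤ 2 * L / 2 ^ b * (2 ^ b / 2) := by gcongr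
    _ = L := by field_simp

/-- The expected error of one coordinate of the output, when a single round is far from `g` with
probability at most `0.14`. -/
theorem expected_error_le {n b T : ℕ} {φ : Reg n b → ℝ} {Λ r g D : ℝ} (i : Fin n) (hr : 0 ≤ r)
    (hfar : ∑ k with r < |estimate Λ k i - g|, measureProb φ k ≤ 7 / 50)
    {out : (Fin T → Reg n b) → ℝ}
    (hout : ∀ k, IsMajorityMedian (2 * r) (fun t => estimate Λ (k t) i) (out k))
    (hD0 : 0 ≤ D) (hD : ∀ k, |g - out k| ≤ D) :
    ∑ k : Fin T → Reg n b, (∏ t, measureProb φ (k t)) * |g - out k|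
      ≤ r + D * Real.exp (-(T : ℝ) / 24) := by
  have hP0 : ∀ k : Fin T → Reg n b, 0 ≤ ∏ t, measureProb φ (k t) := fun k =>
    Finset.prod_nonneg fun t _ => measureProb_nonneg _ _
  have hch := sum_prod_quarter_le T (measureProb_nonneg φ) (sum_measureProb φ)
    (fun k => r < |estimate Λ k i - g|) hfar
  have hterm : ∀ k : Fin T → Reg n b, (∏ t, measureProb φ (k t)) * |g - out k|
      ≤ r * (∏ t, measureProb φ (k t)) + D * if T ≤ 4 * (Finset.univ.filter fun t =>
          r < |estimate Λ (k t) i - g|).card then ∏ t, measureProb φ (k t) else 0 := by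
    intro k
    split_ifs with h
    · have h1 := mul_le_mul_of_nonneg_left (hD k) (hP0 k)
      have h2 := mul_nonneg hr (hP0 k)
      linarith
    · have h1 := (hout k).abs_sub_le (g := g) (not_le.1 h)
      rw [abs_sub_comm] at h1
      have h2 := mul_le_mul_of_nonneg_left h1 (hP0 k)
      linarith
  refine (Finset.sum_le_sum fun k _ => hterm k).trans ?_
  rw [Finset.sum_add_distrib, ← Finset.mul_sum, ← Finset.mul_sum,
    sum_prod_eq_one T (sum_measureProb φ), mul_one, ← Finset.sum_filter]
  gcongr

/-! ### Size of the parameters -/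

/-- The ratio `(n² ε / r₁)^{1/3}` in terms of which all scales of the algorithm are expressed. -/
noncomputable def scaleRatio (n : ℕ) (ε r₁ : ℝ) : ℝ :=
  (n : ℝ) ^ (2 / 3 : ℝ) * ε ^ (1 / 3 : ℝ) / r₁ ^ (1 / 3 : ℝ)

theorem rpow_third_pow_three {x : ℝ} (hx : 0 ≤ x) : (x ^ (1 / 3 : ℝ)) ^ 3 = x := by
  rw [← Real.rpow_natCast, ← Real.rpow_mul hx]
  norm_num

theorem rpow_div_three {x : ℝ} (hx : 0 ≤ x) (k : ℕ) : x ^ (k / 3 : ℝ) = (x ^ (1 / 3 : ℝ)) ^ k := by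
  rw [← Real.rpow_natCast, ← Real.rpow_mul hx]
  congr 1
  ring

section Parameters

variable {n : ℕ} {ε L r₁ : ℝ}

theorem scaleRatio_pos (hn : 0 < n) (hε : 0 < ε) (hr : 0 < r₁) : 0 < scaleRatio n ε r₁ := by
  have : (0 : ℝ) < n := by exact_mod_cast hn
  unfold scaleRatio
  positivity

theorem scaleRatio_pow_three (hε : 0 < ε) (hr : 0 < r₁) :
    scaleRatio n ε r₁ ^ 3 = (n : ℝ) ^ 2 * ε / r₁ := by
  have hn : (0 : ℝ) ≤ n := Nat.cast_nonneg n
  have h2 := rpow_div_three hn 2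
  push_cast at h2
  rw [scaleRatio, div_pow, mul_pow, rpow_third_pow_three hε.le, rpow_third_pow_three hr.le, h2,
    ← pow_mul, mul_comm 2 3, pow_mul, rpow_third_pow_three hn]

theorem bound_eq_scaleRatio :
    5000 * L * (n : ℝ) ^ (5 / 3 : ℝ) * ε ^ (1 / 3 : ℝ) / r₁ ^ (1 / 3 : ℝ)
      = 5000 * L * n * scaleRatio n ε r₁ := by
  have hn : (0 : ℝ) ≤ n := Nat.cast_nonneg n
  have h : (n : ℝ) ^ (5 / 3 : ℝ) = n * (n : ℝ) ^ (2 / 3 : ℝ) := by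
    have h5 := rpow_div_three hn 5
    have h2 := rpow_div_three hn 2
    push_cast at h5 h2
    rw [h5, h2, show (5 : ℕ) = 3 + 2 from rfl, pow_add, rpow_third_pow_three hn]
  rw [h, scaleRatio]
  ring

theorem errScale_smoothParam (hn : 0 < n) (hε : 0 < ε) (hL : 0 < L) (hr : 0 < r₁) :
    errScale n ε (smoothParam n ε L r₁) = Real.sqrt (2 * L) * scaleRatio n ε r₁ := by
  have hn' : (0 : ℝ) < n := by exact_mod_cast hn
  have hτ := scaleRatio_pos hn hε hr
  rw [errScale, Real.sqrt_eq_iff_mul_self_eq (by unfold smoothParam; positivity) (by positivity),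
    mul_mul_mul_comm, Real.mul_self_sqrt (by positivity)]
  have hp := rpow_third_pow_three hn'.le
  have he := rpow_third_pow_three hε.le
  have h2 := rpow_div_three hn'.le 2
  have h2' := rpow_div_three hr.le 2
  push_cast at h2 h2'
  have hp0 : 0 < (n : ℝ) ^ (1 / 3 : ℝ) := by positivity
  have he0 : 0 < ε ^ (1 / 3 : ℝ) := by positivity
  have hr0 : 0 < r₁ ^ (1 / 3 : ℝ) := by positivity
  rw [scaleRatio, smoothParam, h2, h2']
  conv_rhs => rw [← hp, ← he]
  rw [hp, he]
  field_simp
  nth_rewrite 1 [← hp, ← he]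
  ring

/-- An oracle error `ε` across a cell of side `l` blurs slopes by order `ε / l`; this identity says
that `s` is this scale. -/
theorem gridSize_mul_errScale {β : ℝ} (hn : 0 < n) (hε : 0 < ε) (hβ : 0 < β) :
    gridSize n ε β * errScale n ε β = 2 * ε := by
  have hn' : (0 : ℝ) < n := by exact_mod_cast hn
  rw [gridSize, errScale, mul_assoc, ← Real.sqrt_mul (by positivity)]
  have : ε / (n * β) * (n * ε * β) = ε ^ 2 := by field_simp
  rw [this, Real.sqrt_sq hε.le]

theorem smoothParam_pos (hn : 0 < n) (hε : 0 < ε) (hL : 0 < L) (hr : 0 < r₁) :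
    0 < smoothParam n ε L r₁ := by
  have hn' : (0 : ℝ) < n := by exact_mod_cast hn
  unfold smoothParam
  positivity

theorem gridSize_pos {β : ℝ} (hn : 0 < n) (hε : 0 < ε) (hβ : 0 < β) : 0 < gridSize n ε β := by
  have hn' : (0 : ℝ) < n := by exact_mod_cast hn
  unfold gridSize
  positivity

theorem errScale_pos {β : ℝ} (hn : 0 < n) (hε : 0 < ε) (hβ : 0 < β) : 0 < errScale n ε β := by
  have hn' : (0 : ℝ) < n := by exact_mod_cast hn
  unfold errScale
  positivity

theorem errScale_le (hn : 0 < n) (hε : 0 < ε) (hL : 1 ≤ L) (hr : 0 < r₁) :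
    errScale n ε (smoothParam n ε L r₁) ≤ 2 * L * scaleRatio n ε r₁ := by
  rw [errScale_smoothParam hn hε (by linarith) hr]
  have h := (scaleRatio_pos hn hε hr).le
  gcongr
  rw [Real.sqrt_le_left (by linarith)]
  nlinarith

theorem le_errScale (hn : 0 < n) (hε : 0 < ε) (hL : 1 ≤ L) (hr : 0 < r₁) :
    scaleRatio n ε r₁ ≤ errScale n ε (smoothParam n ε L r₁) := by
  rw [errScale_smoothParam hn hε (by linarith) hr]
  refine le_mul_of_one_le_left (scaleRatio_pos hn hε hr).le ?_
  rw [Real.one_le_sqrt]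
  linarith

end Parameters

/-! ### The gradient estimate at a good grid point -/

/-- If `f` is nearly linear on the cell of `y`, then a round of `GradientEstimate` at `y` is accurate
with probability at least `0.86` in each coordinate. -/
theorem sum_measureProb_estimate_far_le {n b b₀ T : ℕ} (hn : 0 < n) (hb : 4 ≤ b) (hT : 0 < T)
    {f α : (Fin n → ℝ) → ℝ} {ε L β : ℝ} (hε : 0 < ε) (hL : 0 < L) (hβ : 0 < β)
    (hα : IsEvalOracle f ε α) (hpar : ValidParams n ε (2 * L) β b b₀ T) {y g : Fin n → ℝ}
    (hg : IsSubgradient f y g) (hgL : ∀ i, |g i| ≤ L)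
    (hlin : ∀ w : Fin n → ℝ, (∀ i, |w i - y i| ≤ gridSize n ε β / 2) →
      f w - f y - ∑ i, g i * (w i - y i) ≤ ε / 10)
    {Ft : Reg n b → ℝ} (hFt : IsPhaseOracle α ε (2 * L) β y b₀ Ft) (i : Fin n) :
    ∑ k with 1500 * errScale n ε β < |estimate (2 * L) k i - g i|, measureProb Ft k ≤ 7 / 50 := by
  have hl := gridSize_pos hn hε hβ
  have hs := errScale_pos hn hε hβ
  have hls := gridSize_mul_errScale hn hε hβ
  obtain ⟨hb1, hb2⟩ := hpar.bits hT
  obtain ⟨-, hp2⟩ := hpar.precision hT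
  obtain ⟨c, hc⟩ := hFt
  set l := gridSize n ε β with hldef
  set s := errScale n ε β with hsdef
  set N : ℝ := 2 ^ b with hNdef
  have hN : 0 < N := by positivity
  have hpi := Real.pi_pos
  set A : ℝ := N / (2 * (2 * L) * l) with hA
  have hA0 : 0 < A := by positivity
  have hAε : A * ε = N * s / (8 * L) := by
    rw [hA]
    field_simp
    linear_combination -4 * hls
  have hAε' : A * ε ≤ 1 / (96 * Real.pi) := by
    rw [hAε, div_le_div_iff₀ (by positivity) (by positivity)]
    rw [div_le_div_iff₀ (by positivity) (by positivity)] at hb1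
    linarith
  have hp2' : (1 : ℝ) / 2 ^ b₀ ≤ 2 * (A * ε) := by
    refine hp2.trans_eq ?_
    rw [hA]
    field_simp
  -- With `Λ = 2L` the frequencies fill only half of the range of `G`, which keeps the tails away
  -- from wrap-around.
  set κ : Fin n → ℝ := fun j => N * g j / (4 * L) with hκdef
  have hκ : ∀ j, |κ j| ≤ N / 4 := by
    intro j
    rw [hκdef]
    simp only
    rw [abs_div, abs_mul, abs_of_pos hN, abs_of_pos (by positivity : 0 < 4 * L),
      div_le_div_iff₀ (by positivity) (by norm_num)]
    have := mul_le_mul_of_nonneg_left (hgL j) hN.le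
    linarith
  have hφ : ∀ u, |Ft u - (A * (f y - c) + ∑ j, gam b (u j) * κ j / N)|
      ≤ 1 / 2 ^ b₀ + A * (ε / 10) := by
    intro u
    set p : Fin n → ℝ := fun j => y j + l / N * gam b (u j) with hp
    have hcell : ∀ j, |p j - y j| ≤ l / 2 := by
      intro j
      have h1 : (u j : ℝ) + 1 ≤ N := by
        rw [hNdef]; exact_mod_cast (u j).isLt
      have h0 : (0 : ℝ) ≤ (u j : ℕ) := Nat.cast_nonneg _
      have hgm : |gam b (u j)| ≤ N / 2 := by rw [abs_le, gam]; constructor <;> linarith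
      rw [hp]
      simp only [add_sub_cancel_left]
      rw [abs_mul, abs_of_pos (by positivity)]
      calc l / N * |gam b (u j)| ≤ l / N * (N / 2) := by gcongr
        _ = l / 2 := by field_simp
    have hup := hlin p hcell
    have hlow := hg p
    have hsum : A * ∑ j, g j * (p j - y j) = ∑ j, gam b (u j) * κ j / N := by
      rw [Finset.mul_sum]
      refine Finset.sum_congr rfl fun j _ => ?_
      rw [hκdef, hp, hA]
      simp only [add_sub_cancel_left]
      field_simp
      ring
    have h1 := hc u
    have h2 := hα p
    have e1 : N * ε / (2 * (2 * L) * l) = A * ε := by rw [hA]; ring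
    rw [e1] at h1
    change |Ft u - A * (α p - c)| + A * ε ≤ 1 / 2 ^ b₀ at h1
    have h3 : |A * (α p - f p)| ≤ A * ε := by
      rw [abs_mul, abs_of_pos hA0]; gcongr
    have h4 : |A * (f p - f y - ∑ j, g j * (p j - y j))| ≤ A * (ε / 10) := by
      rw [abs_mul, abs_of_pos hA0]
      gcongr
      rw [abs_le]
      constructor <;> linarith
    rw [← hsum]
    -- The errors are phase representation, oracle and nonlinearity. `IsPhaseOracle` already
    -- reserves `A ε` for the second, so the first two add up to at most `1/N₀`.
    have e2 : Ft u - (A * (f y - c) + A * ∑ j, g j * (p j - y j))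
        = (Ft u - A * (α p - c)) + A * (α p - f p)
          + A * (f p - f y - ∑ j, g j * (p j - y j)) := by ring
    rw [e2]
    refine (abs_add_three _ _ _).trans ?_
    linarith
  have hη : 2 * Real.pi * (1 / 2 ^ b₀ + A * (ε / 10)) ≤ 7 / 160 := by
    have h1 : 1 / 2 ^ b₀ + A * (ε / 10) ≤ 21 / 10 * (1 / (96 * Real.pi)) := by linarith
    calc 2 * Real.pi * (1 / 2 ^ b₀ + A * (ε / 10))
        ≤ 2 * Real.pi * (21 / 10 * (1 / (96 * Real.pi))) := by gcongr
      _ = 7 / 160 := by field_simp; norm_num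
  -- The upper bound on `1/N` gives `s N / L ≥ 1/(24π)`, so the radius `1500 s`, in frequency units,
  -- is at least `375/(24π) > 4.97`.
  have hw : 497 / 100 ≤ 1500 * s * N / (4 * L) := by
    rw [div_le_div_iff₀ (by positivity) (by positivity)] at hb2
    rw [div_le_div_iff₀ (by norm_num) (by positivity)]
    have := Real.pi_lt_d4
    have h1 : Real.pi * (s * N) ≤ 3.1416 * (s * N) := by gcongr
    linarith
  refine le_trans (le_of_eq ?_) (sum_measureProb_far_le hb hκ hφ hη i hw)
  refine Finset.sum_congr (Finset.filter_congr fun k _ => ?_) fun _ _ => rfl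
  have e : estimate (2 * L) k i - g i = 4 * L / N * (gam b (k i) - κ i) := by
    rw [estimate, hκdef]
    simp only
    field_simp
    ring
  rw [e, abs_mul, abs_of_pos (by positivity), div_lt_iff₀ (by positivity), div_mul_eq_mul_div,
    lt_div_iff₀ hN, mul_comm (4 * L)]

/-! ### Correctness -/

/-- Moving the base point from `y` to `x` costs `n r₁ L` in the value of `f` and `n r₁ L` in the
linear term; replacing `g` by `v` costs the `ℓ₁`–`ℓ_∞` Hölder bound. Only half of the allowance `4 n
r₁ L` is spent. -/
theorem subgradient_inequality {n : ℕ} {f : (Fin n → ℝ) → ℝ} {L r₁ : ℝ} (hr : 0 ≤ r₁)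
    (hf : ConvexOn ℝ Set.univ f) (hL0 : 0 ≤ L) (hL : IsSubgradLipschitz f L) {x y g : Fin n → ℝ}
    (hg : IsSubgradient f y g) (hy : ‖y - x‖ ≤ r₁) (v q : Fin n → ℝ) :
    f x + ∑ i, v i * (q i - x i) - (∑ i, |g i - v i|) * ‖q - x‖ - 4 * n * r₁ * L ≤ f q := by
  have hyi : ∀ i, |y i - x i| ≤ r₁ := fun i => by
    have := norm_le_pi_norm (y - x) i
    rw [Pi.sub_apply, Real.norm_eq_abs] at this
    exact this.trans hy
  have hsum : ∑ i, |y i - x i| ≤ n * r₁ := by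
    refine (Finset.sum_le_sum fun i _ => hyi i).trans_eq ?_
    simp
  have h1 : f x - f y ≤ L * (n * r₁) := by
    refine (sub_le_of_isSubgradLipschitz hf hL x y).trans ?_
    simp only [abs_sub_comm (x _)]
    gcongr
  have h2 := hg q
  have h3 : ∑ i, v i * (q i - x i) - (∑ i, |g i - v i|) * ‖q - x‖ - L * (n * r₁)
      ≤ ∑ i, g i * (q i - y i) := by
    have h4 : L * (n * r₁) = ∑ _i : Fin n, L * r₁ := by simp; ring
    rw [h4, Finset.sum_mul, ← Finset.sum_sub_distrib, ← Finset.sum_sub_distrib]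
    refine Finset.sum_le_sum fun i _ => ?_
    have h5 : |g i - v i| * |q i - x i| ≤ |g i - v i| * ‖q - x‖ := by
      gcongr
      simpa using norm_le_pi_norm (q - x) i
    have h6 : |g i| * |y i - x i| ≤ L * r₁ :=
      mul_le_mul (hL y g hg i) (hyi i) (abs_nonneg _) hL0
    rw [← abs_mul] at h5 h6
    have h7 := neg_abs_le ((g i - v i) * (q i - x i))
    have h8 := le_abs_self (g i * (y i - x i))
    linarith
  have h9 : 0 ≤ L * (n * r₁) := by positivity
  linarith

/-- The main estimate: the expected `ℓ₁`-distance of the output from subgradients at the sampled grid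
points. -/
theorem runExpectation_le {n b b₀ T : ℕ} (hn : 0 < n) {f α : (Fin n → ℝ) → ℝ}
    {ε L r₁ β l : ℝ} {x a : Fin n → ℝ} {Ft : (Fin n → ℤ) → Reg n b → ℝ}
    {out : (Fin n → ℤ) → (Fin T → Reg n b) → Fin n → ℝ} {g : (Fin n → ℤ) → Fin n → ℝ}
    (hf : ConvexOn ℝ Set.univ f) (hL : 1 ≤ L) (hLip : IsSubgradLipschitz f L) (hε : 0 < ε)
    (hr : 0 < r₁) (hα : IsEvalOracle f ε α) (hβ : β = smoothParam n ε L r₁)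
    (hl : l = gridSize n ε β) (hpar : ValidParams n ε (2 * L) β b b₀ T)
    (hFt : 0 < T → ∀ m ∈ gridIn x r₁ a l, IsPhaseOracle α ε (2 * L) β (gridPoint a l m) b₀ (Ft m))
    (hout : ∀ m ∈ gridIn x r₁ a l, IsSmoothOutput ε (2 * L) β (out m))
    (hg : ∀ m, IsSubgradient f (gridPoint a l m) (g m)) :
    runExpectation (gridIn x r₁ a l) Ft (fun m k => ∑ i, |g m i - out m k i|)
      ≤ 5000 * L * n * scaleRatio n ε r₁ := by
  set τ := scaleRatio n ε r₁ with hτdef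
  have hn' : (0 : ℝ) < n := by exact_mod_cast hn
  have hL0 : 0 < L := by linarith
  have hτ : 0 < τ := scaleRatio_pos hn hε hr
  have hβ0 : 0 < β := hβ ▸ smoothParam_pos hn hε hL0 hr
  have hl0 : 0 < l := hl ▸ gridSize_pos hn hε hβ0
  have hs0 : 0 < errScale n ε β := errScale_pos hn hε hβ0
  have hsle : errScale n ε β ≤ 2 * L * τ := hβ ▸ errScale_le hn hε hL hr
  have hles : τ ≤ errScale n ε β := hβ ▸ le_errScale hn hε hL hr
  have hgL : ∀ m i, |g m i| ≤ L := fun m => hLip _ _ (hg m)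
  have hD : ∀ m ∈ gridIn x r₁ a l, ∀ k i, |g m i - out m k i| ≤ 3 * L := by
    intro m hm k i
    have h1 := (hout m hm k i).abs_le (by positivity) fun t => abs_estimate_le (by positivity) _ i
    have h2 := abs_sub (g m i) (out m k i)
    have h3 := hgL m i
    linarith
  have hP0 : ∀ m (k : Fin T → Reg n b), 0 ≤ ∏ t, measureProb (Ft m) (k t) := fun m k =>
    Finset.prod_nonneg fun t _ => measureProb_nonneg _ _
  have hexpD : ∀ m ∈ gridIn x r₁ a l, ∀ i,
      ∑ k : Fin T → Reg n b, (∏ t, measureProb (Ft m) (k t)) * |g m i - out m k i| ≤ 3 * L := by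
    intro m hm i
    calc _ ≤ ∑ k : Fin T → Reg n b, (∏ t, measureProb (Ft m) (k t)) * (3 * L) :=
          Finset.sum_le_sum fun k _ => mul_le_mul_of_nonneg_left (hD m hm k i) (hP0 m k)
      _ = 3 * L := by rw [← Finset.sum_mul, sum_prod_eq_one T (sum_measureProb _), one_mul]
  suffices h : ∑ m ∈ gridIn x r₁ a l, ∑ i, ∑ k : Fin T → Reg n b,
      (∏ t, measureProb (Ft m) (k t)) * |g m i - out m k i|
        ≤ 5000 * L * n * τ * (gridIn x r₁ a l).card by
    rw [runExpectation]
    refine div_le_of_le_mul₀ (by positivity) (by positivity) (le_trans (le_of_eq ?_) h)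
    refine Finset.sum_congr rfl fun m _ => ?_
    rw [Finset.sum_comm]
    exact Finset.sum_congr rfl fun k _ => Finset.mul_sum _ _ _
  -- For `τ ≥ 3/5000` the deterministic bound `3L` per coordinate suffices. Otherwise `s` is so
  -- small that admissibility forces `T > 0` and `N ≥ 16`.
  rcases le_or_gt (3 / 5000) τ with hbig | hsmall
  · refine (Finset.sum_le_card_nsmul _ _ (n * (3 * L)) fun m hm => ?_).trans ?_
    · refine (Finset.sum_le_sum fun i _ => hexpD m hm i).trans_eq ?_
      simp
    · rw [nsmul_eq_mul, mul_comm]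
      have : (n : ℝ) * L * (3 / 5000) ≤ n * L * τ := by gcongr
      exact mul_le_mul_of_nonneg_right (by linarith) (Nat.cast_nonneg _)
  · have hs1 : errScale n ε β < 2 * L * (3 / 5000) := hsle.trans_lt (by gcongr)
    have hT : 0 < T := by
      rcases Nat.eq_zero_or_pos T with h0 | h0
      · exfalso
        have h := hpar.rounds
        rw [h0, le_div_iff₀ (by positivity)] at h
        simp at h
        linarith
      · exact h0
    have hb : 4 ≤ b := by
      have h := (hpar.bits hT).2
      have hpi := Real.pi_lt_d4
      have h1 : 48 * Real.pi * errScale n ε β / (2 * L) < 1 / 8 := by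
        rw [div_lt_div_iff₀ (by positivity) (by norm_num)]
        have : Real.pi * errScale n ε β ≤ 3.1416 * errScale n ε β := by gcongr
        linarith
      have h2 := h.trans_lt h1
      rw [div_lt_div_iff₀ (by positivity) (by norm_num), one_mul, one_mul] at h2
      have h3 : (2 : ℝ) ^ 3 < 2 ^ b := by linarith
      have h4 := (pow_lt_pow_iff_right₀ (by norm_num : (1 : ℝ) < 2)).1 h3
      omega
    have hexp : Real.exp (-(T : ℝ) / 24) * (3 * L) ≤ 1125 / 2 * errScale n ε β := by
      have h := hpar.rounds
      rw [le_div_iff₀ (by positivity)] at h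
      linarith
    set D : (Fin n → ℤ) → ℝ := fun m => secondDiff f (n * l) (gridPoint a l m) with hDdef
    have hD0 : ∀ m, 0 ≤ D m := fun m => secondDiff_nonneg hf _ _
    -- Good points contribute `1500 s` plus the failure term `1125/2 s`, together `4125/2 s`. At bad
    -- points `D m > n ε / 10`, so `3L` is at most the second summand.
    have hm : ∀ m ∈ gridIn x r₁ a l, ∀ i, ∑ k : Fin T → Reg n b,
        (∏ t, measureProb (Ft m) (k t)) * |g m i - out m k i|
          ≤ 4125 / 2 * errScale n ε β + 30 * L / (n * ε) * D m := by
      intro m hm i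
      rcases le_or_gt (D m / n) (ε / 10) with hgood | hbad
      · have hlin : ∀ w : Fin n → ℝ, (∀ i, |w i - gridPoint a l m i| ≤ gridSize n ε β / 2) →
            f w - f (gridPoint a l m) - ∑ i, g m i * (w i - gridPoint a l m i) ≤ ε / 10 := by
          intro w hw
          refine (linearization_error_le hn hf (hg m) (by positivity) fun i => ?_).trans hgood
          have := hw i
          rw [← hl] at this
          gcongr
          linarith
        have hfar := sum_measureProb_estimate_far_le hn hb hT hε hL0 hβ0 hα hpar (hg m) (hgL m)
          hlin (hFt hT m hm) i
        have h := expected_error_le (out := fun k => out m k i) i (by positivity) hfar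
          (fun k => by
            have h := hout m hm k i
            rwa [show 3000 * errScale n ε β = 2 * (1500 * errScale n ε β) by ring] at h)
          (by positivity) (fun k => hD m hm k i)
        have h2 : 0 ≤ 30 * L / (n * ε) * D m := mul_nonneg (by positivity) (hD0 m)
        linarith
      · have h1 : 3 * L ≤ 30 * L / (n * ε) * D m := by
          have e : 30 * L / (n * ε) * D m = 30 * L / ε * (D m / n) := by field_simp
          rw [e]
          calc 3 * L = 30 * L / ε * (ε / 10) := by field_simp; norm_num
            _ ≤ 30 * L / ε * (D m / n) := by gcongr
        have := hexpD m hm i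
        linarith
    have hl2 : l ^ 2 * τ ^ 2 ≤ 2 * ε ^ 2 / L := by
      have h := gridSize_mul_errScale hn hε hβ0
      rw [← hl, hβ, errScale_smoothParam hn hε hL0 hr] at h
      have h2 : (l * (Real.sqrt (2 * L) * τ)) ^ 2 = (2 * ε) ^ 2 := by rw [h]
      rw [mul_pow, mul_pow, Real.sq_sqrt (by positivity)] at h2
      rw [le_div_iff₀ hL0]
      linarith
    have hτ3 : τ ^ 3 = (n : ℝ) ^ 2 * ε / r₁ := scaleRatio_pow_three hε hr
    have hετ : (n : ℝ) ^ 2 * ε = τ ^ 3 * r₁ := by rw [hτ3]; field_simp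
    have hlr : l ≤ r₁ := by
      have h := gridSize_mul_errScale hn hε hβ0
      rw [← hl] at h
      have h1 : l * τ ≤ 2 * ε := h ▸ mul_le_mul_of_nonneg_left hles hl0.le
      have h2 : ε ≤ (n : ℝ) ^ 2 * ε := by
        refine le_mul_of_one_le_left hε.le (one_le_pow₀ ?_)
        exact_mod_cast hn
      have h3 : l * τ ≤ (2 * τ ^ 2 * r₁) * τ := by rw [hετ] at h2; linarith
      have h4 : l ≤ 2 * τ ^ 2 * r₁ := le_of_mul_le_mul_right h3 hτ
      have h5 : 2 * τ ^ 2 ≤ 1 := by nlinarith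
      have h6 := mul_le_mul_of_nonneg_right h5 hr.le
      linarith
    -- The choice of `β` enters here: `l² τ² L ≤ 2ε²` and `n² ε = τ³ r₁` turn the boundary bound
    -- into an average of order `n ε τ`.
    have hDsum : ∑ m ∈ gridIn x r₁ a l, D m ≤ 4 * n * ε * τ * (gridIn x r₁ a l).card := by
      have h := sum_grid_secondDiff_le hf hLip x a hl0 hlr
      have h1 : 2 * (n : ℝ) ^ 3 * l ^ 2 * L ≤ r₁ * (4 * n * ε * τ) := by
        have h2 : l ^ 2 * τ ^ 2 * L ≤ 2 * ε ^ 2 := by rwa [le_div_iff₀ hL0] at hl2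
        refine le_of_mul_le_mul_right ?_ (by positivity : 0 < τ ^ 2)
        calc 2 * (n : ℝ) ^ 3 * l ^ 2 * L * τ ^ 2 = 2 * n ^ 3 * (l ^ 2 * τ ^ 2 * L) := by ring
          _ ≤ 2 * n ^ 3 * (2 * ε ^ 2) := by gcongr
          _ = 4 * n * ε * (n ^ 2 * ε) := by ring
          _ = r₁ * (4 * n * ε * τ) * τ ^ 2 := by rw [hετ]; ring
      refine le_of_mul_le_mul_left (h.trans ?_) hr
      rw [← mul_assoc]
      exact mul_le_mul_of_nonneg_right h1 (Nat.cast_nonneg _)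
    -- With `s ≤ 2Lτ` the constant per coordinate is `4125 + 120 ≤ 5000`.
    have hfinal : ∀ K S : ℝ, 0 ≤ K → S ≤ 4 * n * ε * τ * K →
        n * (4125 / 2 * errScale n ε β * K + 30 * L / (n * ε) * S) ≤ 5000 * L * n * τ * K := by
      clear_value τ
      intro K S hK hS
      have h1 : 30 * L / (n * ε) * S ≤ 30 * L / (n * ε) * (4 * n * ε * τ * K) :=
        mul_le_mul_of_nonneg_left hS (by positivity)
      have h2 : 30 * L / (n * ε) * (4 * n * ε * τ * K) = 120 * (L * τ * K) := by
        field_simp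
        ring
      have h3 : errScale n ε β * K ≤ 2 * L * τ * K := mul_le_mul_of_nonneg_right hsle hK
      have h4 : 0 ≤ L * τ * K := by positivity
      calc n * (4125 / 2 * errScale n ε β * K + 30 * L / (n * ε) * S)
          ≤ n * (5000 * (L * τ * K)) := mul_le_mul_of_nonneg_left (by linarith) hn'.le
        _ = 5000 * L * n * τ * K := by ring
    calc ∑ m ∈ gridIn x r₁ a l, ∑ i, ∑ k : Fin T → Reg n b,
          (∏ t, measureProb (Ft m) (k t)) * |g m i - out m k i|
        ≤ ∑ m ∈ gridIn x r₁ a l, n * (4125 / 2 * errScale n ε β + 30 * L / (n * ε) * D m) := by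
          refine Finset.sum_le_sum fun m hmm => ?_
          refine (Finset.sum_le_sum fun i _ => hm m hmm i).trans_eq ?_
          rw [Finset.sum_const, Finset.card_univ, Fintype.card_fin, nsmul_eq_mul]
      _ = n * (4125 / 2 * errScale n ε β * (gridIn x r₁ a l).card
          + 30 * L / (n * ε) * ∑ m ∈ gridIn x r₁ a l, D m) := by
          rw [← Finset.mul_sum, Finset.sum_add_distrib, ← Finset.mul_sum _ _ (30 * L / (n * ε)),
            Finset.sum_const, nsmul_eq_mul, mul_comm ((gridIn x r₁ a l).card : ℝ)]
      _ ≤ _ := hfinal _ _ (Nat.cast_nonneg _) hDsum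

/-! ### Query complexity -/

theorem exists_inv_two_pow_mem {A : ℝ} (h0 : 0 < A) (h1 : A ≤ 1) :
    ∃ b : ℕ, A ≤ 1 / 2 ^ b ∧ (1 : ℝ) / 2 ^ b ≤ 2 * A := by
  obtain ⟨b, hb1, hb2⟩ := exists_nat_pow_near_of_lt_one h0 h1
    (by norm_num : (0 : ℝ) < 1 / 2) (by norm_num)
  rw [one_div_pow] at hb1 hb2
  rw [pow_succ, ← div_div] at hb1
  exact ⟨b, hb2, by linarith⟩

theorem totalQueries_eq (n b T : ℕ) : totalQueries n b T = T := by
  simp [totalQueries, gradientCircuit, queryCount]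

/-- `X` is the value for which the condition on the rounds reads `e^(T/24) ≥ X`. It is at most `L r₁
/ ε`, because `s ≥ τ ≥ τ³ ≥ ε / r₁` when `τ ≤ 1`. The logarithm on the right is at least one, so
`25` in place of `24` absorbs the rounding up. -/
theorem exists_validParams {n : ℕ} {ε L r₁ : ℝ} (hn : 0 < n) (hL : 1 ≤ L) (hε : 0 < ε)
    (hr : 0 < r₁) (hεr : ε < r₁ / (n : ℝ) ^ 2) :
    ∃ b b₀ T : ℕ, ValidParams n ε (2 * L) (smoothParam n ε L r₁) b b₀ T ∧
      (totalQueries n b T : ℝ) ≤ 25 * Real.log (2 + L * r₁ / ε) := by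
  have hn1 : (1 : ℝ) ≤ n := by exact_mod_cast hn
  have hL0 : 0 < L := by linarith
  set β := smoothParam n ε L r₁ with hβ
  have hβ0 : 0 < β := smoothParam_pos hn hε hL0 hr
  have hs := errScale_pos hn hε hβ0
  have hl := gridSize_pos hn hε hβ0
  have hls := gridSize_mul_errScale hn hε hβ0
  set s := errScale n ε β with hsdef
  set l := gridSize n ε β with hldef
  have hpi := Real.pi_pos
  set X := 4 * L / (750 * s) with hX
  have hX0 : 0 < X := by positivity
  set T := ⌈24 * Real.log X⌉₊ with hTdef
  have hrounds : 2 * Real.exp (-(T : ℝ) / 24) ≤ 750 * s / (2 * L) := by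
    have h1 : Real.log X ≤ (T : ℝ) / 24 := by
      have := Nat.le_ceil (24 * Real.log X)
      rw [← hTdef] at this
      linarith
    have h2 : Real.exp (-(T : ℝ) / 24) ≤ X⁻¹ := by
      rw [← Real.exp_log hX0, ← Real.exp_neg]
      exact Real.exp_le_exp.2 (by linarith)
    calc 2 * Real.exp (-(T : ℝ) / 24) ≤ 2 * X⁻¹ := by gcongr
      _ = 750 * s / (2 * L) := by rw [hX]; field_simp; norm_num
  have hr1 : ε < r₁ := hεr.trans_le (div_le_self hr.le (one_le_pow₀ hn1))
  have hY : 1 ≤ Real.log (2 + L * r₁ / ε) := by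
    rw [Real.le_log_iff_exp_le (by positivity)]
    have h1 : 1 ≤ L * r₁ / ε := by
      rw [one_le_div hε]; nlinarith
    have := Real.exp_one_lt_d9
    linarith
  have hXle : X ≤ 2 + L * r₁ / ε := by
    set τ := scaleRatio n ε r₁ with hτdef
    have hτ : 0 < τ := scaleRatio_pos hn hε hr
    have hτs : τ ≤ s := le_errScale hn hε hL hr
    have hτ3 : τ ^ 3 = (n : ℝ) ^ 2 * ε / r₁ := scaleRatio_pow_three hε hr
    have h1 : τ ^ 3 ≤ 1 := by
      rw [hτ3, div_le_one hr]
      rw [lt_div_iff₀ (by positivity)] at hεr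
      linarith
    have h2 : τ ≤ 1 := by
      by_contra hc
      exact absurd (one_lt_pow₀ (not_le.1 hc) three_ne_zero) (not_lt.2 h1)
    have h3 : ε / r₁ ≤ s := by
      refine le_trans ?_ hτs
      calc ε / r₁ ≤ (n : ℝ) ^ 2 * ε / r₁ := by
            gcongr
            exact le_mul_of_one_le_left hε.le (one_le_pow₀ hn1)
        _ = τ ^ 3 := hτ3.symm
        _ ≤ τ := pow_le_of_le_one hτ.le h2 three_ne_zero
    calc X ≤ 4 * L / (4 * (ε / r₁)) := by rw [hX]; gcongr; norm_num
      _ = L * r₁ / ε := by field_simp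
      _ ≤ 2 + L * r₁ / ε := by linarith
  have hTle : (T : ℝ) ≤ 25 * Real.log (2 + L * r₁ / ε) := by
    rcases le_total (Real.log X) 0 with h | h
    · have : T = 0 := Nat.ceil_eq_zero.2 (by linarith)
      rw [this]
      push_cast
      linarith
    · have h1 := Nat.ceil_lt_add_one (by positivity : 0 ≤ 24 * Real.log X)
      rw [← hTdef] at h1
      have h2 := Real.log_le_log hX0 hXle
      linarith
  rcases Nat.eq_zero_or_pos T with hT | hT
  · refine ⟨0, 0, T, ⟨hrounds, fun h => absurd h (by omega), fun h => absurd h (by omega)⟩, ?_⟩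
    rw [totalQueries_eq]
    exact hTle
  -- A positive `T` means `X > 1`, that is, `750 s < 4L`. This puts both windows low enough to
  -- contain some `2^(-b)` with natural `b`.
  · have hX1 : 1 < X := by
      have h := Nat.ceil_pos.1 hT
      exact (Real.log_pos_iff hX0.le).1 (by linarith)
    rw [hX, one_lt_div (by positivity)] at hX1
    obtain ⟨b, hb1, hb2⟩ := exists_inv_two_pow_mem (A := 24 * Real.pi * s / (2 * L))
      (by positivity) (by
        rw [div_le_one (by positivity)]
        have : Real.pi * s ≤ 4 * s := by gcongr; exact Real.pi_le_four
        linarith)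
    obtain ⟨b₀, hb3, hb4⟩ := exists_inv_two_pow_mem (A := 2 ^ b * ε / (2 * (2 * L) * l))
      (by positivity) (by
        rw [div_le_one (by positivity)]
        rw [div_le_div_iff₀ (by positivity) (by positivity)] at hb1
        have h1 : 2 ^ b * s * 1 ≤ 2 ^ b * s * Real.pi := by
          gcongr
          linarith [Real.pi_gt_three]
        have h2 : 2 ^ b * s ≤ L := by
          have : 0 < (2 : ℝ) ^ b * s := by positivity
          linarith
        calc (2 : ℝ) ^ b * ε = 2 ^ b * s * l / 2 := by linear_combination -(2 ^ b / 2 : ℝ) * hls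
          _ ≤ L * l / 2 := by gcongr
          _ ≤ 2 * (2 * L) * l := by
            have : 0 < L * l := by positivity
            linarith)
    refine ⟨b, b₀, T, ⟨hrounds, fun _ => ⟨hb1, hb2.trans_eq (by ring)⟩,
      fun _ => ⟨hb3, hb4.trans_eq
        (show 2 * (2 ^ b * ε / (2 * (2 * L) * l)) = 2 ^ b * ε / (2 * L * l) by field_simp)⟩⟩, ?_⟩
    rw [totalQueries_eq]
    exact hTle

end QSubgrad

theorem mainTheorem7 :
    -- correctness, for every admissible choice of the parameters
    (∀ (n : ℕ), 0 < n →
      ∀ (f α : (Fin n → ℝ) → ℝ) (ε L r₁ β l : ℝ) (x a : Fin n → ℝ) (b b₀ T : ℕ)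
        (Ft : (Fin n → ℤ) → QSubgrad.Reg n b → ℝ)
        (out : (Fin n → ℤ) → (Fin T → QSubgrad.Reg n b) → Fin n → ℝ),
      ConvexOn ℝ Set.univ f → 1 ≤ L → QSubgrad.IsSubgradLipschitz f L →
      0 < ε → 0 < r₁ → ε < min 1 (r₁ / (n : ℝ) ^ 2) → QSubgrad.IsEvalOracle f ε α →
      β = QSubgrad.smoothParam n ε L r₁ → l = QSubgrad.gridSize n ε β →
      QSubgrad.ValidParams n ε (2 * L) β b b₀ T →
      (0 < T → ∀ m ∈ QSubgrad.gridIn x r₁ a l,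
        QSubgrad.IsPhaseOracle α ε (2 * L) β (QSubgrad.gridPoint a l m) b₀ (Ft m)) →
      (∀ m ∈ QSubgrad.gridIn x r₁ a l, QSubgrad.IsSmoothOutput ε (2 * L) β (out m)) →
      ∃ ζ : (Fin n → ℤ) → (Fin T → QSubgrad.Reg n b) → ℝ,
        (∀ m ∈ QSubgrad.gridIn x r₁ a l, ∀ (k : Fin T → QSubgrad.Reg n b) (q : Fin n → ℝ),
          f q ≥ f x + ∑ i, out m k i * (q i - x i) - ζ m k * ‖q - x‖ - 4 * n * r₁ * L) ∧
        QSubgrad.runExpectation (QSubgrad.gridIn x r₁ a l) Ft ζ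
          ≤ 5000 * L * (n : ℝ) ^ (5 / 3 : ℝ) * ε ^ (1 / 3 : ℝ) / r₁ ^ (1 / 3 : ℝ)) ∧
    -- query complexity: there is an admissible choice with logarithmically many queries
    (∃ C : ℝ, 0 < C ∧ ∀ (n : ℕ) (ε L r₁ : ℝ), 0 < n → 1 ≤ L → 0 < ε → 0 < r₁ →
      ε < min 1 (r₁ / (n : ℝ) ^ 2) →
      ∃ b b₀ T : ℕ,
        QSubgrad.ValidParams n ε (2 * L) (QSubgrad.smoothParam n ε L r₁) b b₀ T ∧
        (QSubgrad.totalQueries n b T : ℝ) ≤ C * Real.log (2 + L * r₁ / ε)) := by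
  refine ⟨?_, 25, by norm_num, ?_⟩
  · intro n hn f α ε L r₁ β l x a b b₀ T Ft out hf hL hLip hε hr _ hα hβ hl hpar hFt hout
    choose g hg using fun m => QSubgrad.exists_isSubgradient hf (QSubgrad.gridPoint a l m)
    have hl0 : 0 < l := by
      rw [hl, hβ]
      exact QSubgrad.gridSize_pos hn hε (QSubgrad.smoothParam_pos hn hε (by linarith) hr)
    refine ⟨fun m k => ∑ i, |g m i - out m k i|, fun m hm k q => ?_, ?_⟩
    · exact QSubgrad.subgradient_inequality hr.le hf (by linarith) hLip (hg m)
        ((QSubgrad.mem_gridIn x hr.le a hl0 m).1 hm) (out m k) q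
    · rw [QSubgrad.bound_eq_scaleRatio]
      exact QSubgrad.runExpectation_le hn hf hL hLip hε hr hα hβ hl hpar hFt hout hg
  · intro n ε L r₁ hn hL hε hr hεr
    exact QSubgrad.exists_validParams hn hL hε hr (lt_min_iff.1 hεr).2
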